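/- **Setting.** Let $\mathcal S,\mathcal A$ be finite sets (with $S=|\mathcal S|$, $D=|\mathcal S\times\mathcal A|$) and consider a discounted MDP with discount factor $\gamma\in(0,1)$, transition kernel $P(\cdot\mid s,a)$ and nonnegative random rewards $R(s,a)$ with mean $r(s,a)=\mathbb E R(s,a)$. For a stationary, possibly randomized policy $\pi$ let $Q^\pi(s,a)=\mathbb E_\pi\big[\sum_{t\ge0}\gamma^t r(s_t,a_t)\mid s_0=s,a_0=a\big]$, $V^\pi(s)=\sum_a\pi(a\mid s)Q^\pi(s,a)$, $Q^*=\sup_\pi Q^\pi$ and $V^*=\sup_\pi V^\pi$; $\pi$ is optimal if $V^\pi(s)=V^*(s)$ for all $s$. Let $\mathbf P\in\mathbb R^{D\times S}$ be the transition matrix, $\mathbf\Pi^\pi=\mathrm{diag}\{\pi(\cdot|1)^\top,\dots,\pi(\cdot|S)^\top\}\in\mathbb R^{S\times D}$, $\mathbf P^\pi=\mathbf P\mathbf\Pi^\pi$ and $\mathbf P_\pi=\mathbf\Pi^\pi\mathbf P$. In each iteration $t\ge1$ one observes, for every $(s,a)$, a reward $r_t(s,a)\sim R(s,a)$ and a next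 state $s_t(s,a)\sim P(\cdot\mid s,a)$, all independent over $(s,a)$, over $t$, and between rewards and next states. From an arbitrary deterministic $Q_0\in\mathbb R^D$, synchronous Q-learning with step sizes $\eta_t$ is $$Q_t=(1-\eta_t)Q_{t-1}+\eta_t\widehat{\mathcal T}_tQ_{t-1},\qquad (\widehat{\mathcal T}_tQ)(s,a)=r_t(s,a)+\gamma\max_{a'}Q(s_t(s,a),a').$$ Let $\bar Q_T=\frac1T\sum_{t=1}^TQ_t$ and $\bar V_T(s)=\max_a\bar Q_T(s,a)$. With the Bellman operator $(\mathcal TQ)(s,a)=r(s,a)+\gamma\,\mathbb E_{s'\sim P(\cdot\mid s,a)}\max_{a'}Q(s',a')$, the Bellman noise is $Z_t=\widehat{\mathcal T}_tQ^*-\mathcal TQ^*$ (i.i.d. in $t$), and $Z$ denotes a copy of it. **Assumptions.** (1) $\mathbb E|R(s,a)|^4<\infty$ for all $(s,a)$. (2) The optimal policy $\pi^*$ is unique. (3) $\eta_t\in(0,1]$ for all $t\ge0$; $\eta_t$ is nonincreasing with $\eta_t\to0$; $t\eta_t$ is nondecreasing with $t\eta_t\to\infty$; $\frac{\eta_{t-1}-\eta_t}{\eta_{t-1}}=o(\eta_{t-1})$;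 $\frac1{\sqrt T}\sum_{t=0}^T\eta_t\to0$ as $T\to\infty$; and there is a constant $C$ with $\frac{\sum_{t=0}^T\eta_t}{T\eta_T}\le C$ for all $T\ge1$. **Conclusion.** The matrices $I-\gamma\mathbf P_{\pi^*}$ and $I-\gamma\mathbf P^{\pi^*}$ are invertible. Put $$\mathrm{Var}_Q=(I-\gamma\mathbf P^{\pi^*})^{-1}\mathrm{Var}(Z)(I-\gamma\mathbf P^{\pi^*})^{-\top},\qquad \mathrm{Var}_V=(I-\gamma\mathbf P_{\pi^*})^{-1}\mathrm{Var}(\mathbf\Pi^{\pi^*}Z)(I-\gamma\mathbf P_{\pi^*})^{-\top}.$$ Then $\mathrm{Var}_V$ is positive semidefinite, $\mathrm{Var}_V=\mathbf\Pi^{\pi^*}\,\mathrm{Var}_Q\,(\mathbf\Pi^{\pi^*})^\top$, and, as $T\to\infty$, $$\sqrt T\,(\bar V_T-V^*)\ \xrightarrow{\,d\,}\ \mathcal N(0,\mathrm{Var}_V).$$ -/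

import Mathlib

open MeasureTheory ProbabilityTheory Filter Topology Matrix

namespace QLearning

/-- Covariance matrix of a random vector `X`. -/
noncomputable def covMatrix {Ω ι : Type*} [MeasurableSpace Ω] (X : Ω → ι → ℝ) (μ : Measure Ω) :
    Matrix ι ι ℝ :=
  Matrix.of fun i j => covariance (fun ω => X ω i) (fun ω => X ω j) μ

/-- A discounted infinite-horizon MDP with state space `S`, action space `A`, discount factor
`γ ∈ (0,1)`, transition kernel `P(· | s, a)` and nonnegative random rewards, the reward collected
at `(s, a)` having law `R (s, a)`. -/
structure MDP (S A : Type*) where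
  γ : ℝ
  γ_pos : 0 < γ
  γ_lt_one : γ < 1
  P : S × A → PMF S
  R : S × A → ProbabilityMeasure ℝ
  R_nonneg : ∀ x, ∀ᵐ y ∂(R x : Measure ℝ), 0 ≤ y

/-- A (stationary, possibly randomized) policy. -/
abbrev Policy (S A : Type*) := S → PMF A

/-- The greedy value `s ↦ max_a Q(s, a)` of a Q-function (used for finite `A`). -/
noncomputable def greedyValue {S A : Type*} (Q : S × A → ℝ) (s : S) : ℝ := ⨆ a : A, Q (s, a)

namespace MDP

variable {S A : Type*} [Fintype S] [Fintype A] [DecidableEq S] [DecidableEq A]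
  [MeasurableSpace S] [MeasurableSingletonClass S]
  [MeasurableSpace A] [MeasurableSingletonClass A] (M : MDP S A)

/-- Expected reward `r(s, a) = E R(s, a)`. -/
noncomputable def r (x : S × A) : ℝ := ∫ y, y ∂(M.R x : Measure ℝ)

/-! ### Trajectories and value functions -/

/-- One step of the chain of state-action pairs under `π`:
from `(s, a)` draw `s' ∼ P(· | s, a)` and then `a' ∼ π(· | s')`. -/
noncomputable def stepKernel (π : Policy S A) : Kernel (S × A) (S × A) :=
  Kernel.ofFunOfCountable fun x =>
    ((M.P x).bind fun s' => (π s').map fun a' => (s', a')).toMeasure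

instance (π : Policy S A) : IsMarkovKernel (M.stepKernel π) :=
  ⟨fun _ => PMF.toMeasure.isProbabilityMeasure _⟩

/-- The law of the next state-action pair given the history up to time `n`. -/
noncomputable def historyKernel (π : Policy S A) (n : ℕ) :
    Kernel ((_i : Finset.Iic n) → S × A) (S × A) :=
  (M.stepKernel π).comap (fun h => h ⟨n, Finset.mem_Iic.2 le_rfl⟩) (measurable_pi_apply _)

instance (π : Policy S A) (n : ℕ) : IsMarkovKernel (M.historyKernel π n) := by
  unfold historyKernel
  exact Kernel.IsMarkovKernel.comap _ _

/-- The law of the trajectory `(s_t, a_t)_{t ≥ 0}` under `π`, started at `(s_0, a_0) = x`. -/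
noncomputable def trajLaw (π : Policy S A) (x : S × A) : Measure (ℕ → S × A) :=
  Kernel.traj (X := fun _ => S × A) (M.historyKernel π) 0 (fun _ => x)

/-- `Q^π(s, a) = E_π[∑_t γ^t r(s_t, a_t) | s_0 = s, a_0 = a]`. -/
noncomputable def Qπ (π : Policy S A) (x : S × A) : ℝ :=
  ∫ ω, ∑' t : ℕ, M.γ ^ t * M.r (ω t) ∂(M.trajLaw π x)

/-- `V^π(s) = ∑_a π(a | s) Q^π(s, a)`. -/
noncomputable def Vπ (π : Policy S A) (s : S) : ℝ :=
  ∑ a, (π s a).toReal * M.Qπ π (s, a)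

/-- The optimal Q-function. -/
noncomputable def Qstar (x : S × A) : ℝ := ⨆ π : Policy S A, M.Qπ π x

/-- The optimal value function. -/
noncomputable def Vstar (s : S) : ℝ := ⨆ π : Policy S A, M.Vπ π s

/-- A policy is optimal if it attains the optimal value at every state. -/
def IsOptimal (π : Policy S A) : Prop := ∀ s, M.Vπ π s = M.Vstar s

/-! ### Matrices -/

/-- The transition matrix `P ∈ ℝ^{D × S}`. -/
noncomputable def Pmat : Matrix (S × A) S ℝ := Matrix.of fun x s' => (M.P x s').toReal

end MDP

/-- The projection matrix `Π^π = diag{π(·|1)ᵀ, …, π(·|S)ᵀ} ∈ ℝ^{S × D}`. -/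
noncomputable def projMat {S A : Type*} [DecidableEq S] (π : Policy S A) : Matrix S (S × A) ℝ :=
  Matrix.of fun s x => if x.1 = s then (π s x.2).toReal else 0

namespace MDP

variable {S A : Type*} [Fintype S] [Fintype A] [DecidableEq S] [DecidableEq A]
  [MeasurableSpace S] [MeasurableSingletonClass S]
  [MeasurableSpace A] [MeasurableSingletonClass A] (M : MDP S A)

/-- `P^π = P Π^π ∈ ℝ^{D × D}`. -/
noncomputable def PupMat (π : Policy S A) : Matrix (S × A) (S × A) ℝ := M.Pmat * projMat π

/-- `P_π = Π^π P ∈ ℝ^{S × S}`. -/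
noncomputable def PdownMat (π : Policy S A) : Matrix S S ℝ := projMat π * M.Pmat

/-! ### Generative model, Bellman operators and Bellman noise -/

/-- The observations of one iteration: for each `(s, a)` a pair (reward, next state). -/
abbrev Sample (S A : Type*) := S × A → ℝ × S

/-- The law of one iteration's observations under the generative model: rewards `∼ R(s, a)` and
next states `∼ P(· | s, a)`, all independent. -/
noncomputable def sampleLaw : Measure (Sample S A) :=
  Measure.pi fun x => (M.R x : Measure ℝ).prod (M.P x).toMeasure

/-- The empirical Bellman operator
`(T̂ Q)(s, a) = r_t(s, a) + γ max_{a'} Q(s_t(s, a), a')`. -/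
noncomputable def empBellman (ξ : Sample S A) (Q : S × A → ℝ) (x : S × A) : ℝ :=
  (ξ x).1 + M.γ * greedyValue Q (ξ x).2

/-- The Bellman operator
`(T Q)(s, a) = r(s, a) + γ E_{s' ∼ P(· | s, a)} max_{a'} Q(s', a')`. -/
noncomputable def bellman (Q : S × A → ℝ) (x : S × A) : ℝ :=
  M.r x + M.γ * ∑ s', (M.P x s').toReal * greedyValue Q s'

/-- The Bellman noise `Z = T̂(Q*) - T(Q*)`. -/
noncomputable def bellmanNoise (ξ : Sample S A) (x : S × A) : ℝ :=
  M.empBellman ξ M.Qstar x - M.bellman M.Qstar x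

/-- `Var_Q = (I - γ P^π)⁻¹ Var(Z) (I - γ P^π)⁻ᵀ`. -/
noncomputable def varQ (π : Policy S A) : Matrix (S × A) (S × A) ℝ :=
  (1 - M.γ • M.PupMat π)⁻¹ * covMatrix M.bellmanNoise M.sampleLaw *
    ((1 - M.γ • M.PupMat π)⁻¹)ᵀ

/-- `Var_V = (I - γ P_π)⁻¹ Var(Π^π Z) (I - γ P_π)⁻ᵀ`. -/
noncomputable def varV (π : Policy S A) : Matrix S S ℝ :=
  (1 - M.γ • M.PdownMat π)⁻¹ *
    covMatrix (fun ξ => projMat π *ᵥ M.bellmanNoise ξ) M.sampleLaw *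
    ((1 - M.γ • M.PdownMat π)⁻¹)ᵀ

/-! ### Synchronous Q-learning -/

/-- The Q-learning iterates along a realization `ξ` of the observations:
`Q_t = (1 - η_t) Q_{t-1} + η_t T̂_t Q_{t-1}`, where `T̂_t` uses the observations `ξ t`. -/
noncomputable def iterate (η : ℕ → ℝ) (Q₀ : S × A → ℝ) (ξ : ℕ → Sample S A) : ℕ → S × A → ℝ
  | 0 => Q₀
  | t + 1 => fun x =>
      (1 - η (t + 1)) * iterate η Q₀ ξ t x
        + η (t + 1) * M.empBellman (ξ (t + 1)) (iterate η Q₀ ξ t) x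

/-- `Q̄_T = (1/T) ∑_{t=1}^T Q_t`. -/
noncomputable def avgQ (η : ℕ → ℝ) (Q₀ : S × A → ℝ) (ξ : ℕ → Sample S A) (T : ℕ) (x : S × A) : ℝ :=
  (1 / (T : ℝ)) * ∑ t ∈ Finset.Icc 1 T, M.iterate η Q₀ ξ t x

/-- The greedy value estimate `V̄_T(s) = max_a Q̄_T(s, a)`. -/
noncomputable def avgV (η : ℕ → ℝ) (Q₀ : S × A → ℝ) (ξ : ℕ → Sample S A) (T : ℕ) : S → ℝ :=
  greedyValue (M.avgQ η Q₀ ξ T)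

/-- The random observations `ξ t`, `t ≥ 1`, are independent over iterations and each has the law
prescribed by the generative model. -/
structure IsGenerative {Ω : Type*} [MeasurableSpace Ω] (μ : Measure Ω)
    (ξ : ℕ → Ω → Sample S A) : Prop where
  measurable : ∀ t, 1 ≤ t → Measurable (ξ t)
  law : ∀ t, 1 ≤ t → μ.map (ξ t) = M.sampleLaw
  indep : iIndepFun (fun t : ℕ => ξ (t + 1)) μ

/-- All random rewards have finite fourth moment. -/
def FourthMoment : Prop := ∀ x, Integrable (fun y : ℝ => |y| ^ 4) (M.R x : Measure ℝ)

end MDP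

/-- The step-size condition. -/
structure StepSize (η : ℕ → ℝ) : Prop where
  pos : ∀ t, 0 < η t
  le_one : ∀ t, η t ≤ 1
  antitone : Antitone η
  tendsto_zero : Tendsto η atTop (𝓝 0)
  monotone_mul : Monotone fun t : ℕ => (t : ℝ) * η t
  tendsto_mul : Tendsto (fun t : ℕ => (t : ℝ) * η t) atTop atTop
  isLittleO : (fun t : ℕ => (η t - η (t + 1)) / η t) =o[atTop] η
  sum_sqrt : Tendsto (fun T : ℕ => (1 / √(T : ℝ)) * ∑ t ∈ Finset.range (T + 1), η t) atTop (𝓝 0)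
  sum_le : ∃ C : ℝ, ∀ T : ℕ, 1 ≤ T → (∑ t ∈ Finset.range (T + 1), η t) / ((T : ℝ) * η T) ≤ C

end QLearning

/-!
Averaged Q-learning is analysed as a linear stochastic approximation with a quadratic perturbation.

The dynamic programming part turns uniqueness of the optimal policy into a gap. The law of the
trajectory gives the Bellman equation of each policy (`Qπ_eq`); policy improvement shows that every
policy that is greedy for `Q*` is optimal, so that `V* = max_a Q*` and `Q*` is the fixed point of
the Bellman operator; hence a unique optimal policy is deterministic, `s ↦ b s`, and `b s` is the
strict maximizer of `Q* (s, ·)` (`exists_unique_greedy`). Because of the gap,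
`max_a Q (s, a) = Q (s, b s) + O(‖Q - Q*‖²)` (`exists_greedyValue_sub_le`): the Bellman operator
differs from its linearization `r + γ P Π` at `Q*` only to second order.

The second ingredient is the rate `E ‖Q_t - Q*‖² = O(η_t)` (`exists_integral_error_le`). The noise
of iteration `t` is orthogonal to the past, so the exponentially weighted noise average `X_t` has
`E ‖X_t‖² = O(η_t)` coordinate by coordinate. After subtraction of `X_t` the recursion is a pathwise
sup-norm contraction, `‖D_{t+1}‖ ≤ (1 - (1 - γ) η_{t+1}) ‖D_t‖ + γ η_{t+1} ‖X_t‖`, and convexity of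
the square carries the rate over to `D_t = Q_t - Q* - X_t`. This needs only second moments and no
smooth Lyapunov function.

The conclusion is then the argument of Polyak and Ruppert. Solving one step for the error before the
step and summing (`sum_error_eq`) expresses the sum of the errors of the greedy actions as
`(I - γ P_π)⁻¹` applied to the sum of the Bellman noises plus three terms: a martingale with
increments of variance `O(η_t)`, linearization errors bounded by `‖Q_t - Q*‖²`, and a telescoping
sum handled by summation by parts. After division by `√T` all three tend to zero in `L¹`, and so
does the error of replacing `max_a` of the averaged iterates by its value at `b s`
(`exists_remainder`). What remains is a normalized sum of i.i.d. vectors; its limit follows from the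
one-dimensional central limit theorem by the Cramér–Wold device
(`tendstoInDistribution_inv_sqrt_smul_sum`), and Slutsky's theorem finishes the proof.
-/

set_option linter.unusedSectionVars false

namespace QLearning

/-! ### The Bellman equation of a policy -/

lemma sum_toReal_pmf {α : Type*} [Fintype α] (p : PMF α) : ∑ a, (p a).toReal = 1 := by
  rw [← ENNReal.toReal_sum fun a _ => p.apply_ne_top a, ← tsum_fintype (L := .unconditional _),
    p.tsum_coe, ENNReal.toReal_one]

lemma sum_toReal_pmf_mul_le {α : Type*} [Fintype α] (p : PMF α) {f : α → ℝ} {c : ℝ}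
    (h : ∀ a, f a ≤ c) : ∑ a, (p a).toReal * f a ≤ c := by
  calc ∑ a, (p a).toReal * f a ≤ ∑ a, (p a).toReal * c :=
        Finset.sum_le_sum fun a _ => mul_le_mul_of_nonneg_left (h a) ENNReal.toReal_nonneg
    _ = c := by rw [← Finset.sum_mul, sum_toReal_pmf, one_mul]

lemma abs_sum_toReal_pmf_mul_le {α : Type*} [Fintype α] (p : PMF α) {f : α → ℝ} {c : ℝ}
    (h : ∀ a, |f a| ≤ c) : |∑ a, (p a).toReal * f a| ≤ c := by
  refine abs_le.2 ⟨?_, sum_toReal_pmf_mul_le p fun a => (abs_le.1 (h a)).2⟩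
  have := sum_toReal_pmf_mul_le p (f := fun a => - f a) (c := c) fun a => by
    linarith [(abs_le.1 (h a)).1]
  simp only [mul_neg, Finset.sum_neg_distrib] at this
  linarith

namespace MDP

section Bellman

variable {S A : Type*} [Fintype S] [Fintype A] (M : MDP S A)

/-- The value at `s` of a Q-function `f` when the action is drawn from `π (· | s)`. -/
noncomputable def policyValue (π : Policy S A) (f : S × A → ℝ) (s : S) : ℝ :=
  ∑ a, (π s a).toReal * f (s, a)

/-- The transition operator of the chain of state-action pairs under `π`. -/
noncomputable def nextMean (π : Policy S A) (f : S × A → ℝ) (x : S × A) : ℝ :=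
  ∑ s', (M.P x s').toReal * policyValue π f s'

lemma abs_policyValue_le (π : Policy S A) {f : S × A → ℝ} {c : ℝ} (h : ∀ x, |f x| ≤ c) (s : S) :
    |policyValue π f s| ≤ c := abs_sum_toReal_pmf_mul_le _ fun a => h (s, a)

lemma abs_nextMean_le (π : Policy S A) {f : S × A → ℝ} {c : ℝ} (h : ∀ x, |f x| ≤ c)
    (x : S × A) : |M.nextMean π f x| ≤ c :=
  abs_sum_toReal_pmf_mul_le _ fun s => abs_policyValue_le π h s

lemma abs_nextMean_iterate_le (π : Policy S A) {f : S × A → ℝ} {c : ℝ} (h : ∀ x, |f x| ≤ c)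
    (n : ℕ) : ∀ x, |(M.nextMean π)^[n] f x| ≤ c := by
  induction n with
  | zero => exact h
  | succ n ih =>
    rw [Function.iterate_succ_apply']
    exact M.abs_nextMean_le π ih

lemma exists_abs_r_le : ∃ c : ℝ, ∀ x, |M.r x| ≤ c :=
  ⟨‖M.r‖, fun x => norm_le_pi_norm M.r x⟩

variable [MeasurableSpace S] [MeasurableSingletonClass S]
  [MeasurableSpace A] [MeasurableSingletonClass A]

lemma integral_stepKernel (π : Policy S A) (f : S × A → ℝ) (x : S × A) :
    ∫ y, f y ∂(M.stepKernel π x) = M.nextMean π f x := by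
  classical
  change ∫ y, f y ∂((M.P x).bind fun s' => (π s').map fun a' => (s', a')).toMeasure = _
  rw [PMF.integral_eq_sum, Fintype.sum_prod_type]
  unfold nextMean policyValue
  refine Finset.sum_congr rfl fun s _ => ?_
  rw [Finset.mul_sum]
  refine Finset.sum_congr rfl fun a _ => ?_
  rw [smul_eq_mul, ← mul_assoc, ← ENNReal.toReal_mul]
  congr 2
  rw [PMF.bind_apply, tsum_eq_single s, PMF.map_apply, tsum_eq_single a]
  · simp
  · intro b hb; simp [hb.symm]
  · intro b hb; simp [PMF.map_apply, hb.symm]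

instance (π : Policy S A) (x : S × A) : IsProbabilityMeasure (M.trajLaw π x) := by
  unfold trajLaw; infer_instance

lemma integrable_trajLaw_eval (π : Policy S A) (f : S × A → ℝ) (x : S × A) (n : ℕ) :
    Integrable (fun ω => f (ω n)) (M.trajLaw π x) := by
  refine Integrable.of_bound ?_ ‖f‖ (ae_of_all _ fun ω => norm_le_pi_norm f _)
  exact (Measurable.of_discrete.comp (measurable_pi_apply n)).aestronglyMeasurable

/-- The Markov property of the trajectory, for functions of a single coordinate. -/
lemma integral_trajLaw_succ (π : Policy S A) (f : S × A → ℝ) (x : S × A) (n : ℕ) :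
    ∫ ω, f (ω (n + 1)) ∂(M.trajLaw π x) = ∫ ω, M.nextMean π f (ω n) ∂(M.trajLaw π x) := by
  have h1 : ∫ ω, f (ω (n + 1)) ∂(M.trajLaw π x)
      = ∫ y, M.nextMean π f (y ⟨n, Finset.mem_Iic.2 le_rfl⟩)
        ∂(Kernel.partialTraj (X := fun _ => S × A) (M.historyKernel π) 0 n (fun _ => x)) := by
    have hi := M.integrable_trajLaw_eval π f x (n + 1)
    unfold trajLaw at hi ⊢
    rw [← Kernel.traj_comp_partialTraj (Nat.zero_le n)] at hi ⊢
    rw [Kernel.integral_comp hi]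
    refine integral_congr_ae (ae_of_all _ fun y => ?_)
    have h2 := congrArg (fun κ => κ y)
      (Kernel.map_traj_succ_self (X := fun _ => S × A) (κ := M.historyKernel π) (a := n))
    beta_reduce at h2
    rw [Kernel.map_apply _ (measurable_pi_apply _)] at h2
    have h3 : ∫ z, f z ∂(M.historyKernel π n y)
        = M.nextMean π f (y ⟨n, Finset.mem_Iic.2 le_rfl⟩) := by
      rw [historyKernel, Kernel.comap_apply, integral_stepKernel]
    rw [← h2, integral_map (measurable_pi_apply _).aemeasurable
      Measurable.of_discrete.aestronglyMeasurable] at h3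
    exact h3
  rw [h1]
  unfold trajLaw
  rw [← Kernel.traj_map_frestrictLe_apply, integral_map (by fun_prop)]
  · rfl
  · exact ((Measurable.of_discrete (f := M.nextMean π f)).comp
      (measurable_pi_apply _)).aestronglyMeasurable

lemma integral_trajLaw_zero (π : Policy S A) (f : S × A → ℝ) (x : S × A) :
    ∫ ω, f (ω 0) ∂(M.trajLaw π x) = f x := by
  have h := Kernel.traj_map_frestrictLe_apply (X := fun _ => S × A) (κ := M.historyKernel π) 0 0
    (fun _ => x)
  rw [Kernel.partialTraj_self, Kernel.id_apply] at h
  have h3 : ∫ y, f (y ⟨0, Finset.mem_Iic.2 le_rfl⟩)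
      ∂(Measure.dirac (fun _ => x) : Measure ((i : Finset.Iic 0) → S × A)) = f x := by
    rw [integral_dirac']
    exact (Measurable.of_discrete.comp (measurable_pi_apply _)).stronglyMeasurable
  rw [← h3, ← h, integral_map (by fun_prop)]
  · rfl
  · exact (Measurable.of_discrete.comp (measurable_pi_apply _)).aestronglyMeasurable

lemma integral_trajLaw (π : Policy S A) (x : S × A) (n : ℕ) (f : S × A → ℝ) :
    ∫ ω, f (ω n) ∂(M.trajLaw π x) = (M.nextMean π)^[n] f x := by
  induction n generalizing f with
  | zero => exact M.integral_trajLaw_zero π f x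
  | succ n ih => rw [integral_trajLaw_succ, ih, Function.iterate_succ_apply]

lemma summable_discounted (π : Policy S A) (x : S × A) :
    Summable fun n : ℕ => M.γ ^ n * (M.nextMean π)^[n] M.r x := by
  obtain ⟨c, h⟩ := M.exists_abs_r_le
  refine Summable.of_norm_bounded
    ((summable_geometric_of_lt_one M.γ_pos.le M.γ_lt_one).mul_right c) fun n => ?_
  rw [norm_mul, norm_pow, Real.norm_of_nonneg M.γ_pos.le]
  exact mul_le_mul_of_nonneg_left (M.abs_nextMean_iterate_le π h n x) (pow_nonneg M.γ_pos.le n)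

lemma Qπ_eq_tsum (π : Policy S A) (x : S × A) :
    M.Qπ π x = ∑' n : ℕ, M.γ ^ n * (M.nextMean π)^[n] M.r x := by
  obtain ⟨c, h⟩ := M.exists_abs_r_le
  unfold Qπ
  rw [← integral_tsum_of_summable_integral_norm]
  · simp_rw [integral_const_mul, M.integral_trajLaw]
  · exact fun n => (M.integrable_trajLaw_eval π M.r x n).const_mul _
  · refine Summable.of_nonneg_of_le (fun n => integral_nonneg fun _ => norm_nonneg _) (fun n => ?_)
      ((summable_geometric_of_lt_one M.γ_pos.le M.γ_lt_one).mul_right c)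
    calc _ ≤ ∫ ω, M.γ ^ n * c ∂(M.trajLaw π x) := by
          refine integral_mono ((M.integrable_trajLaw_eval π M.r x n).const_mul _).norm
            (integrable_const _) fun ω => ?_
          simp only [norm_mul, norm_pow, Real.norm_of_nonneg M.γ_pos.le]
          exact mul_le_mul_of_nonneg_left (h _) (pow_nonneg M.γ_pos.le n)
      _ = _ := by simp

lemma Vπ_eq (π : Policy S A) : M.Vπ π = policyValue π (M.Qπ π) := rfl

/-- The Bellman equation of a policy. -/
lemma Qπ_eq (π : Policy S A) (x : S × A) :
    M.Qπ π x = M.r x + M.γ * ∑ s', (M.P x s').toReal * M.Vπ π s' := by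
  have hs := fun y => M.summable_discounted π y
  rw [Qπ_eq_tsum, (hs x).tsum_eq_zero_add]
  simp only [pow_zero, Function.iterate_zero, id_eq, one_mul]
  congr 1
  simp_rw [Function.iterate_succ_apply', Vπ, Qπ_eq_tsum, pow_succ', mul_assoc]
  rw [tsum_mul_left]
  congr 1
  have key : ∀ s', ∑ a, (π s' a).toReal * ∑' n : ℕ, M.γ ^ n * (M.nextMean π)^[n] M.r (s', a)
      = ∑' n : ℕ, M.γ ^ n * policyValue π ((M.nextMean π)^[n] M.r) s' := fun s' => by
    simp_rw [← tsum_mul_left]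
    rw [← Summable.tsum_finsetSum fun a _ => (hs _).mul_left _]
    refine tsum_congr fun n => ?_
    rw [policyValue, Finset.mul_sum]
    exact Finset.sum_congr rfl fun a _ => by ring
  simp_rw [key, nextMean, ← tsum_mul_left, Finset.mul_sum]
  rw [Summable.tsum_finsetSum]
  · refine Finset.sum_congr rfl fun s' _ => tsum_congr fun n => by ring
  · intro s' _
    have : Summable fun n : ℕ => ∑ a, (M.P x s').toReal * ((π s' a).toReal
        * (M.γ ^ n * (M.nextMean π)^[n] M.r (s', a))) :=
      summable_sum fun a _ => ((hs (s', a)).mul_left _).mul_left _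
    refine this.congr fun n => ?_
    simp_rw [policyValue, Finset.mul_sum]
    exact Finset.sum_congr rfl fun a _ => by ring

lemma abs_Qπ_le {c : ℝ} (h : ∀ x, |M.r x| ≤ c) (π : Policy S A) (x : S × A) :
    |M.Qπ π x| ≤ (1 - M.γ)⁻¹ * c := by
  rw [Qπ_eq_tsum, ← Real.norm_eq_abs]
  refine tsum_of_norm_bounded
    ((hasSum_geometric_of_lt_one M.γ_pos.le M.γ_lt_one).mul_right c) fun n => ?_
  rw [norm_mul, norm_pow, Real.norm_of_nonneg M.γ_pos.le]
  exact mul_le_mul_of_nonneg_left (M.abs_nextMean_iterate_le π h n x) (pow_nonneg M.γ_pos.le n)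

lemma bddAbove_Qπ (x : S × A) : BddAbove (Set.range fun π : Policy S A => M.Qπ π x) := by
  obtain ⟨c, h⟩ := M.exists_abs_r_le
  exact ⟨_, by rintro _ ⟨π, rfl⟩; exact (abs_le.1 (M.abs_Qπ_le h π x)).2⟩

lemma bddAbove_Vπ (s : S) : BddAbove (Set.range fun π : Policy S A => M.Vπ π s) := by
  obtain ⟨c, h⟩ := M.exists_abs_r_le
  exact ⟨_, by rintro _ ⟨π, rfl⟩; exact (abs_le.1 (abs_policyValue_le π (M.abs_Qπ_le h π) s)).2⟩

lemma Vπ_le_Vstar (π : Policy S A) (s : S) : M.Vπ π s ≤ M.Vstar s :=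
  le_ciSup (M.bddAbove_Vπ s) π

end Bellman
end MDP

/-! ### Greedy values and optimal policies -/

section Greedy

variable {S A : Type*} [Fintype S] [Fintype A]

lemma le_greedyValue (Q : S × A → ℝ) (s : S) (a : A) : Q (s, a) ≤ greedyValue Q s :=
  le_ciSup (f := fun a => Q (s, a)) (Set.finite_range _).bddAbove a

lemma greedyValue_le [Nonempty A] {Q : S × A → ℝ} {s : S} {c : ℝ} (h : ∀ a, Q (s, a) ≤ c) :
    greedyValue Q s ≤ c := ciSup_le h

lemma abs_greedyValue_sub_le (Q Q' : S × A → ℝ) (s : S) :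
    |greedyValue Q s - greedyValue Q' s| ≤ ‖Q - Q'‖ := by
  rcases isEmpty_or_nonempty A with hA | hA
  · simp [greedyValue]
  · have key : ∀ Q Q' : S × A → ℝ, greedyValue Q s ≤ greedyValue Q' s + ‖Q - Q'‖ := by
      intro Q Q'
      refine greedyValue_le fun a => ?_
      have h1 := (le_abs_self _).trans (norm_le_pi_norm (Q - Q') (s, a))
      have h2 := le_greedyValue Q' s a
      simp only [Pi.sub_apply] at h1
      linarith
    rw [abs_le]
    have h1 := key Q Q'
    have h2 := key Q' Q
    rw [norm_sub_rev] at h2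
    constructor <;> linarith

lemma abs_greedyValue_le (Q : S × A → ℝ) (s : S) : |greedyValue Q s| ≤ ‖Q‖ := by
  have h := abs_greedyValue_sub_le Q 0 s
  have h0 : greedyValue (0 : S × A → ℝ) s = 0 := by simp [greedyValue]
  simpa [h0] using h

/-- If `b s` is the unique maximizer of `q (s, ·)` for every `s`, then replacing the maximum of a
perturbation `Q` of `q` by its value at `b s` costs only a second-order error. Indeed another
action can only win if twice the perturbation exceeds the gap `g`, and `2 n - g ≤ n ^ 2 / g`. -/
lemma exists_greedyValue_sub_le {q : S × A → ℝ} {b : S → A}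
    (h : ∀ s a, a ≠ b s → q (s, a) < q (s, b s)) :
    ∃ L : ℝ, 0 ≤ L ∧ ∀ Q s, greedyValue Q s - Q (s, b s) ≤ L * ‖Q - q‖ ^ 2 := by
  have hpos : ∀ x : S × A, 0 ≤ |q (x.1, b x.1) - q x|⁻¹ := fun x => by positivity
  refine ⟨∑ x : S × A, |q (x.1, b x.1) - q x|⁻¹, Finset.sum_nonneg fun x _ => hpos x,
    fun Q s => ?_⟩
  have : Nonempty A := ⟨b s⟩
  rw [sub_le_iff_le_add]
  refine greedyValue_le fun a => ?_
  rw [← sub_le_iff_le_add]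
  by_cases ha : a = b s
  · rw [ha, sub_self]
    exact mul_nonneg (Finset.sum_nonneg fun x _ => hpos x) (sq_nonneg _)
  · have hg := sub_pos.2 (h s a ha)
    have hle := Finset.single_le_sum (fun x _ => hpos x) (Finset.mem_univ ((s, a) : S × A))
    refine le_trans ?_ (mul_le_mul_of_nonneg_right hle (sq_nonneg _))
    dsimp only
    rw [abs_of_pos hg]
    set g := q (s, b s) - q (s, a)
    have h1 := (le_abs_self _).trans (norm_le_pi_norm (Q - q) (s, a))
    have h2 := (neg_abs_le _).trans' (neg_le_neg (norm_le_pi_norm (Q - q) (s, b s)))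
    simp only [Pi.sub_apply] at h1 h2
    set n := ‖Q - q‖
    have h3 : 2 * n - g ≤ g⁻¹ * n ^ 2 := by
      rw [inv_mul_eq_div, le_div_iff₀ hg]
      nlinarith [sq_nonneg (n - g)]
    have h4 : g = q (s, b s) - q (s, a) := rfl
    linarith

end Greedy

namespace MDP

section Optimal

variable {S A : Type*} [Fintype S] [Fintype A] (M : MDP S A)

lemma policyValue_le_greedyValue (π : Policy S A) (Q : S × A → ℝ) (s : S) :
    policyValue π Q s ≤ greedyValue Q s :=
  sum_toReal_pmf_mul_le _ fun a => le_greedyValue Q s a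

lemma policyValue_mono (π : Policy S A) {f g : S × A → ℝ} (h : ∀ x, f x ≤ g x) (s : S) :
    policyValue π f s ≤ policyValue π g s :=
  Finset.sum_le_sum fun _ _ => mul_le_mul_of_nonneg_left (h _) ENNReal.toReal_nonneg

lemma policyValue_pure (b : S → A) (f : S × A → ℝ) (s : S) :
    policyValue (fun s => PMF.pure (b s)) f s = f (s, b s) := by
  unfold policyValue
  rw [Finset.sum_eq_single (b s)]
  · simp
  · intro a _ ha; simp [ha]
  · simp

/-- A discounted chain admits no positive subharmonic function. -/
lemma nonpos_of_le_nextMean (π : Policy S A) {f : S × A → ℝ}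
    (h : ∀ x, f x ≤ M.γ * M.nextMean π f x) (x : S × A) : f x ≤ 0 := by
  have : Nonempty (S × A) := ⟨x⟩
  obtain ⟨y, hy⟩ := Finite.exists_max f
  have h1 : M.nextMean π f y ≤ f y :=
    sum_toReal_pmf_mul_le _ fun _ => sum_toReal_pmf_mul_le _ fun _ => hy _
  have h2 := h y
  have h3 := mul_le_mul_of_nonneg_left h1 M.γ_pos.le
  have h4 := M.γ_lt_one
  have h5 : f y ≤ 0 := by nlinarith
  exact (hy x).trans h5

variable [MeasurableSpace S] [MeasurableSingletonClass S]
  [MeasurableSpace A] [MeasurableSingletonClass A] {M}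

lemma IsOptimal.Qstar_eq {π : Policy S A} (hπ : M.IsOptimal π) (x : S × A) :
    M.Qstar x = M.r x + M.γ * ∑ s', (M.P x s').toReal * M.Vstar s' := by
  apply le_antisymm
  · have : Nonempty (Policy S A) := ⟨π⟩
    refine ciSup_le fun π' => ?_
    rw [Qπ_eq]
    gcongr with s'
    · exact M.γ_pos.le
    · exact M.Vπ_le_Vstar π' s'
  · calc _ = M.Qπ π x := by
          rw [Qπ_eq]; simp_rw [hπ _]
      _ ≤ _ := le_ciSup (M.bddAbove_Qπ x) π

lemma IsOptimal.Qπ_eq_Qstar {π : Policy S A} (hπ : M.IsOptimal π) : M.Qπ π = M.Qstar := by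
  ext x
  rw [hπ.Qstar_eq, Qπ_eq]
  simp_rw [hπ _]

lemma IsOptimal.Vstar_le {π : Policy S A} (hπ : M.IsOptimal π) (s : S) :
    M.Vstar s ≤ greedyValue M.Qstar s := by
  rw [← hπ s, Vπ_eq, hπ.Qπ_eq_Qstar]
  exact policyValue_le_greedyValue _ _ _

/-- Policy improvement: a policy that is greedy for `Q*` has a value of at least `max_a Q*`. -/
lemma IsOptimal.greedyValue_le_Vπ {π π' : Policy S A} (hπ : M.IsOptimal π)
    (hπ' : ∀ s, policyValue π' M.Qstar s = greedyValue M.Qstar s) (s : S) :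
    greedyValue M.Qstar s ≤ M.Vπ π' s := by
  have h1 : ∀ x, M.Qstar x - M.Qπ π' x ≤ 0 := by
    refine M.nonpos_of_le_nextMean π' fun x => ?_
    rw [hπ.Qstar_eq, Qπ_eq, add_sub_add_left_eq_sub, ← mul_sub, ← Finset.sum_sub_distrib]
    refine mul_le_mul_of_nonneg_left (Finset.sum_le_sum fun s' _ => ?_) M.γ_pos.le
    rw [← mul_sub]
    refine mul_le_mul_of_nonneg_left ?_ ENNReal.toReal_nonneg
    have h2 : policyValue π' (fun x => M.Qstar x - M.Qπ π' x) s'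
        = greedyValue M.Qstar s' - M.Vπ π' s' := by
      rw [← hπ', Vπ_eq]
      simp only [policyValue, mul_sub, Finset.sum_sub_distrib]
    rw [h2]
    linarith [hπ.Vstar_le s']
  rw [← hπ', Vπ_eq]
  exact policyValue_mono _ (fun x => by linarith [h1 x]) s

lemma IsOptimal.Vstar_eq_greedyValue {π : Policy S A} (hπ : M.IsOptimal π) (s : S) :
    M.Vstar s = greedyValue M.Qstar s := by
  refine le_antisymm (hπ.Vstar_le s) ?_
  have : Nonempty A := (π s).support_nonempty.to_type
  choose b hb using fun s => Finite.exists_max fun a => M.Qstar (s, a)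
  refine (hπ.greedyValue_le_Vπ (π' := fun s => PMF.pure (b s)) (fun s => ?_) s).trans
    (M.Vπ_le_Vstar _ s)
  rw [policyValue_pure]
  exact le_antisymm (le_greedyValue _ _ _) (greedyValue_le (hb s))

lemma IsOptimal.bellman_Qstar {π : Policy S A} (hπ : M.IsOptimal π) (x : S × A) :
    M.bellman M.Qstar x = M.Qstar x := by
  rw [hπ.Qstar_eq, bellman]
  simp_rw [hπ.Vstar_eq_greedyValue]

/-- Uniqueness of the optimal policy forces it to be deterministic, with a strict gap in `Q*`
between the optimal action and all others: every selection of maximizers of `Q*` is optimal. -/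
lemma exists_unique_greedy {πstar : Policy S A}
    (hopt : ∀ π : Policy S A, M.IsOptimal π ↔ π = πstar) :
    ∃ b : S → A, πstar = (fun s => PMF.pure (b s)) ∧
      ∀ s a, a ≠ b s → M.Qstar (s, a) < M.Qstar (s, b s) := by
  classical
  have hπ : M.IsOptimal πstar := (hopt _).2 rfl
  have hA : ∀ s : S, Nonempty A := fun s => (πstar s).support_nonempty.to_type
  choose b hb using fun s => haveI := hA s; Finite.exists_max fun a => M.Qstar (s, a)
  -- Every selection of maximizers is optimal, hence equal to `πstar`.
  have key : ∀ c : S → A, (∀ s a, M.Qstar (s, a) ≤ M.Qstar (s, c s)) →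
      (fun s => PMF.pure (c s)) = πstar := by
    intro c hc
    rw [← hopt]
    intro s
    refine le_antisymm (M.Vπ_le_Vstar _ s) ?_
    rw [hπ.Vstar_eq_greedyValue]
    refine hπ.greedyValue_le_Vπ (fun s => ?_) s
    have := hA s
    rw [policyValue_pure]
    exact le_antisymm (le_greedyValue _ _ _) (greedyValue_le (hc s))
  refine ⟨b, (key b hb).symm, fun s a hab => lt_of_not_ge fun hle => hab ?_⟩
  -- A second maximizer `a` at `s` would give a second optimal policy.
  have h1 := key (Function.update b s a) fun s' a' => by
    by_cases hs : s' = s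
    · subst hs
      rw [Function.update_self]
      exact (hb _ _).trans hle
    · rw [Function.update_of_ne hs]
      exact hb _ _
  have h2 := congrFun (h1.trans (key b hb).symm) s
  simp only [Function.update_self] at h2
  have h3 : a ∈ (PMF.pure (b s)).support := by rw [← h2]; simp
  simpa using h3

end Optimal
end MDP

/-! ### Matrices -/

section Matrices

/-- A matrix that does not increase the sup norm, scaled by a discount factor, leaves `1 - γ B`
invertible. -/
lemma isUnit_one_sub_smul {ι : Type*} [Fintype ι] [DecidableEq ι] {B : Matrix ι ι ℝ} {γ : ℝ}
    (h0 : 0 ≤ γ) (h1 : γ < 1) (hB : ∀ v : ι → ℝ, ‖B *ᵥ v‖ ≤ ‖v‖) : IsUnit (1 - γ • B) := by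
  rw [← Matrix.mulVec_injective_iff_isUnit]
  refine (injective_iff_map_eq_zero (1 - γ • B).mulVecLin).2 fun v hv => ?_
  have h2 : v = γ • (B *ᵥ v) := by
    rw [← sub_eq_zero, ← hv]
    rw [mulVecLin_apply, sub_mulVec, smul_mulVec, one_mulVec]
  have h3 : ‖v‖ ≤ γ * ‖v‖ := by
    calc ‖v‖ = γ * ‖B *ᵥ v‖ := by
          conv_lhs => rw [h2]
          rw [norm_smul, Real.norm_of_nonneg h0]
      _ ≤ _ := mul_le_mul_of_nonneg_left (hB v) h0
  have h4 : ‖v‖ ≤ 0 := by nlinarith [norm_nonneg v]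
  exact norm_le_zero_iff.1 h4

variable {S A : Type*} [Fintype S] [Fintype A] [DecidableEq S] [DecidableEq A] (M : MDP S A)

lemma projMat_mulVec (π : Policy S A) (f : S × A → ℝ) :
    projMat π *ᵥ f = MDP.policyValue π f := by
  ext s
  simp only [mulVec, dotProduct, projMat, of_apply, MDP.policyValue, Fintype.sum_prod_type]
  rw [Finset.sum_eq_single s]
  · simp
  · intro s' _ hs; simp [hs]
  · simp

namespace MDP

lemma Pmat_mulVec (v : S → ℝ) (x : S × A) :
    (M.Pmat *ᵥ v) x = ∑ s', (M.P x s').toReal * v s' := rfl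

lemma norm_Pmat_mulVec_le (v : S → ℝ) : ‖M.Pmat *ᵥ v‖ ≤ ‖v‖ :=
  (pi_norm_le_iff_of_nonneg (norm_nonneg v)).2 fun x =>
    abs_sum_toReal_pmf_mul_le (M.P x) fun s => norm_le_pi_norm v s

lemma norm_projMat_mulVec_le (π : Policy S A) (f : S × A → ℝ) : ‖projMat π *ᵥ f‖ ≤ ‖f‖ := by
  rw [projMat_mulVec]
  exact (pi_norm_le_iff_of_nonneg (norm_nonneg f)).2 fun s =>
    abs_policyValue_le π (fun x => norm_le_pi_norm f x) s

lemma isUnit_one_sub_PdownMat (π : Policy S A) : IsUnit (1 - M.γ • M.PdownMat π) :=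
  isUnit_one_sub_smul M.γ_pos.le M.γ_lt_one fun v => by
    rw [PdownMat, ← mulVec_mulVec]
    exact (norm_projMat_mulVec_le _ _).trans (M.norm_Pmat_mulVec_le v)

lemma isUnit_one_sub_PupMat (π : Policy S A) : IsUnit (1 - M.γ • M.PupMat π) :=
  isUnit_one_sub_smul M.γ_pos.le M.γ_lt_one fun f => by
    rw [PupMat, ← mulVec_mulVec]
    exact (M.norm_Pmat_mulVec_le _).trans (norm_projMat_mulVec_le _ _)

lemma projMat_mul_one_sub (π : Policy S A) :
    projMat π * (1 - M.γ • M.PupMat π) = (1 - M.γ • M.PdownMat π) * projMat π := by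
  rw [PupMat, PdownMat, Matrix.mul_sub, Matrix.sub_mul, Matrix.mul_one, Matrix.one_mul,
    Matrix.mul_smul, Matrix.smul_mul, Matrix.mul_assoc]

/-- The push-through identity for the resolvents. -/
lemma inv_PdownMat_mul_projMat (π : Policy S A) :
    (1 - M.γ • M.PdownMat π)⁻¹ * projMat π = projMat π * (1 - M.γ • M.PupMat π)⁻¹ := by
  have h1 := (Matrix.isUnit_iff_isUnit_det _).1 (M.isUnit_one_sub_PdownMat π)
  have h2 := (Matrix.isUnit_iff_isUnit_det _).1 (M.isUnit_one_sub_PupMat π)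
  rw [← Matrix.mul_nonsing_inv_cancel_right _ (_ * _) h2, Matrix.mul_assoc _ (projMat π),
    projMat_mul_one_sub, Matrix.nonsing_inv_mul_cancel_left _ _ h1]

end MDP

section Covariance

variable {Ω ι κ : Type*} [MeasurableSpace Ω] [Fintype ι] [Fintype κ]
  {μ : Measure Ω} [IsFiniteMeasure μ]

lemma covMatrix_mulVec {X : Ω → ι → ℝ} (hX : ∀ i, MemLp (fun ω => X ω i) 2 μ)
    (B : Matrix κ ι ℝ) :
    covMatrix (fun ω => B *ᵥ X ω) μ = B * covMatrix X μ * Bᵀ := by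
  ext i j
  simp only [covMatrix, of_apply, mulVec, dotProduct, Matrix.mul_apply, transpose_apply]
  rw [covariance_fun_sum_fun_sum (fun k => (hX k).const_mul _) (fun k => (hX k).const_mul _)]
  simp_rw [covariance_const_mul_left, covariance_const_mul_right, Finset.sum_mul]
  rw [Finset.sum_comm]
  exact Finset.sum_congr rfl fun k _ => Finset.sum_congr rfl fun l _ => by ring

lemma dotProduct_covMatrix_mulVec {X : Ω → ι → ℝ} (hX : ∀ i, MemLp (fun ω => X ω i) 2 μ)
    (v : ι → ℝ) : v ⬝ᵥ covMatrix X μ *ᵥ v = Var[fun ω => v ⬝ᵥ X ω; μ] := by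
  simp only [dotProduct]
  rw [variance_fun_sum (fun k => (hX k).const_mul _)]
  simp_rw [covariance_const_mul_left, covariance_const_mul_right]
  simp only [mulVec, dotProduct, covMatrix, of_apply, Finset.mul_sum]
  exact Finset.sum_congr rfl fun k _ => Finset.sum_congr rfl fun l _ => by ring

lemma posSemidef_covMatrix {X : Ω → ι → ℝ} (hX : ∀ i, MemLp (fun ω => X ω i) 2 μ) :
    (covMatrix X μ).PosSemidef := by
  refine Matrix.PosSemidef.of_dotProduct_mulVec_nonneg ?_ fun v => ?_
  · ext i j
    simp [covMatrix, covariance_comm]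
  · rw [star_trivial, dotProduct_covMatrix_mulVec hX]
    exact variance_nonneg _ _

end Covariance

end Matrices

/-! ### Step sizes -/

namespace StepSize

variable {η : ℕ → ℝ} (hη : StepSize η)
include hη

lemma le_two_mul_succ {t : ℕ} (ht : 1 ≤ t) : η t ≤ 2 * η (t + 1) := by
  have h := hη.monotone_mul (Nat.le_succ t)
  simp only [Nat.succ_eq_add_one, Nat.cast_add, Nat.cast_one] at h
  have h1 : (1 : ℝ) ≤ t := by exact_mod_cast ht
  have h2 := hη.pos (t + 1)
  have h3 : (t : ℝ) * η t ≤ t * (2 * η (t + 1)) := by nlinarith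
  exact le_of_mul_le_mul_left h3 (by linarith)

/-- A contractive recursion driven by a forcing term of size `η_{t+1} η_t` stays of size `η_t`.
The step sizes vary slowly enough, `(1 - c/2 η_{t+1}) η_t ≤ η_{t+1}`, for `C η` to be a
supersolution. -/
lemma exists_le_mul_of_recursion {c K : ℝ} (hc : 0 < c) (hc1 : c ≤ 1) (hK : 0 ≤ K) {u : ℕ → ℝ}
    (hu : ∀ t, u (t + 1) ≤ (1 - c * η (t + 1)) * u t + K * η (t + 1) * η t) :
    ∃ C : ℝ, 0 ≤ C ∧ ∀ t, u t ≤ C * η t := by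
  -- The first condition gives `η_t - η_{t+1} ≤ c/4 η_t²`, the second `η_t ≤ 2 η_{t+1}`.
  have hev : ∀ᶠ t in atTop, (1 - c / 2 * η (t + 1)) * η t ≤ η (t + 1) := by
    filter_upwards [hη.isLittleO.def (show 0 < c / 4 by positivity), eventually_ge_atTop 1]
      with t ht h1
    have hp := hη.pos t
    have h2 := hη.le_two_mul_succ h1
    rw [Real.norm_of_nonneg hp.le] at ht
    have h3 := (le_abs_self _).trans ht
    rw [div_le_iff₀ hp] at h3
    nlinarith [mul_le_mul_of_nonneg_left h2 (mul_pos hc hp).le]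
  obtain ⟨N, hN⟩ := eventually_atTop.1 hev
  -- The first summand makes `C η` a supersolution from `N` on; the second covers the times up to
  -- `N`.
  set C := 2 * K / c + ∑ t ∈ Finset.range (N + 1), |u t| / η t with hC
  have hnn : ∀ t, 0 ≤ |u t| / η t := fun t => div_nonneg (abs_nonneg _) (hη.pos t).le
  have hS : 0 ≤ ∑ t ∈ Finset.range (N + 1), |u t| / η t := Finset.sum_nonneg fun t _ => hnn t
  have hK' : 0 ≤ 2 * K / c := by positivity
  have hCK : K ≤ c / 2 * C := by
    have : c / 2 * (2 * K / c) = K := by field_simp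
    rw [hC, mul_add, this]
    have := mul_nonneg (by positivity : 0 ≤ c / 2) hS
    linarith
  have hC0 : 0 ≤ C := by positivity
  have hsmall : ∀ t ≤ N, u t ≤ C * η t := by
    intro t ht
    have h1 := Finset.single_le_sum (fun i _ => hnn i) (Finset.mem_range_succ_iff.2 ht)
    have h2 : |u t| / η t ≤ C := by linarith
    rw [div_le_iff₀ (hη.pos t)] at h2
    exact (le_abs_self _).trans h2
  refine ⟨C, hC0, fun t => ?_⟩
  rcases le_total t N with ht | ht
  · exact hsmall t ht
  · induction t, ht using Nat.le_induction with
    | base => exact hsmall N le_rfl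
    | succ t ht ih =>
      have hp := hη.pos t
      have hp' := hη.pos (t + 1)
      have hcη : 0 ≤ 1 - c * η (t + 1) := by nlinarith [hη.le_one (t + 1)]
      calc u (t + 1) ≤ (1 - c * η (t + 1)) * u t + K * η (t + 1) * η t := hu t
        _ ≤ (1 - c * η (t + 1)) * (C * η t) + c / 2 * C * η (t + 1) * η t := by gcongr
        _ = C * ((1 - c / 2 * η (t + 1)) * η t) := by ring
        _ ≤ C * η (t + 1) := mul_le_mul_of_nonneg_left (hN t ht) hC0

lemma inv_succ_sub_inv_nonneg (t : ℕ) : 0 ≤ (η (t + 1))⁻¹ - (η t)⁻¹ :=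
  sub_nonneg.2 (inv_anti₀ (hη.pos _) (hη.antitone (Nat.le_succ t)))

lemma inv_succ_sub_inv_le {t : ℕ} (ht : 1 ≤ t) :
    (η (t + 1))⁻¹ - (η t)⁻¹ ≤ ((t : ℝ) * η t)⁻¹ := by
  have h := hη.monotone_mul (Nat.le_succ t)
  simp only [Nat.succ_eq_add_one, Nat.cast_add, Nat.cast_one] at h
  have h1 : (0 : ℝ) < t := by exact_mod_cast ht
  have hp := hη.pos t
  have hp' := hη.pos (t + 1)
  rw [sub_le_iff_le_add, inv_le_comm₀ hp' (by positivity)]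
  have : ((t : ℝ) * η t)⁻¹ + (η t)⁻¹ = (t + 1) / (t * η t) := by field_simp; ring
  rw [this, inv_div, div_le_iff₀ (by positivity)]
  linarith

lemma tendsto_inv_sqrt_mul : Tendsto (fun t : ℕ => (√((t : ℝ) * η t))⁻¹) atTop (𝓝 0) :=
  tendsto_inv_atTop_zero.comp (Real.tendsto_sqrt_atTop.comp hη.tendsto_mul)

/-- The boundary term of the summation by parts. -/
lemma tendsto_inv_sqrt_mul_inv_mul_sqrt :
    Tendsto (fun T : ℕ => 1 / √(T : ℝ) * ((η T)⁻¹ * √(η T))) atTop (𝓝 0) := by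
  refine hη.tendsto_inv_sqrt_mul.congr fun T => ?_
  have hp := Real.sqrt_pos.2 (hη.pos T)
  rw [Real.sqrt_mul (Nat.cast_nonneg T), mul_inv, one_div]
  congr 1
  conv_rhs => rw [← Real.mul_self_sqrt (hη.pos T).le]
  rw [Real.sqrt_mul_self hp.le]
  field_simp

omit hη in
lemma sum_inv_sqrt_le (n : ℕ) : ∑ t ∈ Finset.range n, (√((t : ℝ) + 1))⁻¹ ≤ 2 * √(n : ℝ) := by
  induction n with
  | zero => simp
  | succ n ih =>
    rw [Finset.sum_range_succ, Nat.cast_add, Nat.cast_one]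
    have h0 : 0 < √((n : ℝ) + 1) := Real.sqrt_pos.2 (by positivity)
    have h1 := Real.sq_sqrt (show (0 : ℝ) ≤ (n : ℝ) + 1 by positivity)
    have h2 := Real.sq_sqrt (show (0 : ℝ) ≤ (n : ℝ) by positivity)
    have h3 : (√((n : ℝ) + 1))⁻¹ ≤ 2 * √((n : ℝ) + 1) - 2 * √(n : ℝ) := by
      rw [inv_le_iff_one_le_mul₀ h0]
      nlinarith [sq_nonneg (√((n : ℝ) + 1) - √(n : ℝ))]
    linarith

/-- The interior terms of the summation by parts: `√η_t (1/η_{t+1} - 1/η_t)` is at most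
`1 / (√t √(t η_t))`, hence `o(1/√t)`. -/
lemma tendsto_sum_inv_sub_inv :
    Tendsto (fun T : ℕ => 1 / √(T : ℝ) *
      ∑ t ∈ Finset.range T, ((η (t + 1))⁻¹ - (η t)⁻¹) * √(η t)) atTop (𝓝 0) := by
  have hlim : Tendsto (fun t : ℕ => √2 * (√((t : ℝ) * η t))⁻¹) atTop (𝓝 0) := by
    simpa using hη.tendsto_inv_sqrt_mul.const_mul (√2)
  have hlo : (fun t : ℕ => ((η (t + 1))⁻¹ - (η t)⁻¹) * √(η t)) =o[atTop]
      fun t : ℕ => (√((t : ℝ) + 1))⁻¹ := by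
    refine Asymptotics.IsLittleO.of_bound fun ε hε => ?_
    filter_upwards [hlim.eventually_lt_const hε, eventually_ge_atTop 1] with t ht h1
    have h1' : (1 : ℝ) ≤ t := by exact_mod_cast h1
    have hp := hη.pos t
    have hs := Real.sqrt_pos.2 hp
    have ht0 : 0 < √(t : ℝ) := Real.sqrt_pos.2 (by linarith)
    have ht1 : 0 < √((t : ℝ) + 1) := Real.sqrt_pos.2 (by linarith)
    rw [Real.norm_of_nonneg (mul_nonneg (hη.inv_succ_sub_inv_nonneg t) hs.le),
      Real.norm_of_nonneg (by positivity), ← div_eq_mul_inv, le_div_iff₀ ht1]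
    have h2 : √((t : ℝ) + 1) ≤ √2 * √(t : ℝ) := by
      rw [← Real.sqrt_mul (by norm_num)]
      exact Real.sqrt_le_sqrt (by linarith)
    calc ((η (t + 1))⁻¹ - (η t)⁻¹) * √(η t) * √((t : ℝ) + 1)
        ≤ ((t : ℝ) * η t)⁻¹ * √(η t) * (√2 * √(t : ℝ)) := by
          gcongr
          exact hη.inv_succ_sub_inv_le h1
      _ = √2 * (√((t : ℝ) * η t))⁻¹ := by
          have e : (t : ℝ) * η t = √((t : ℝ) * η t) * √((t : ℝ) * η t) :=
            (Real.mul_self_sqrt (by positivity)).symm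
          rw [e, Real.sqrt_mul_self (Real.sqrt_nonneg _), Real.sqrt_mul (by linarith)]
          field_simp
      _ ≤ ε := ht.le
  have hdiv : Tendsto (fun n : ℕ => ∑ t ∈ Finset.range n, (√((t : ℝ) + 1))⁻¹) atTop atTop := by
    refine tendsto_atTop_mono (fun n => ?_)
      (Real.tendsto_sqrt_atTop.comp tendsto_natCast_atTop_atTop)
    rcases Nat.eq_zero_or_pos n with rfl | hn
    · simp
    have hn' : 0 < √(n : ℝ) := Real.sqrt_pos.2 (by exact_mod_cast hn)
    calc (Real.sqrt ∘ Nat.cast) n = ∑ t ∈ Finset.range n, (√(n : ℝ))⁻¹ := by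
          rw [Finset.sum_const, Finset.card_range, nsmul_eq_mul, Function.comp_apply]
          rw [← div_eq_mul_inv, eq_div_iff hn'.ne', Real.mul_self_sqrt (Nat.cast_nonneg n)]
      _ ≤ _ := Finset.sum_le_sum fun t ht => by
          have h1 : (t : ℝ) + 1 ≤ n := by exact_mod_cast Finset.mem_range.1 ht
          exact inv_anti₀ (Real.sqrt_pos.2 (by positivity)) (Real.sqrt_le_sqrt h1)
  have hsum := hlo.sum_range (fun t => by positivity) hdiv
  have hO : (fun n : ℕ => ∑ t ∈ Finset.range n, (√((t : ℝ) + 1))⁻¹) =O[atTop]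
      fun n : ℕ => √(n : ℝ) := by
    refine Asymptotics.IsBigO.of_bound 2 (Eventually.of_forall fun n => ?_)
    rw [Real.norm_of_nonneg (Finset.sum_nonneg fun t _ => by positivity),
      Real.norm_of_nonneg (Real.sqrt_nonneg _)]
    exact sum_inv_sqrt_le n
  refine (hsum.trans_isBigO hO).tendsto_div_nhds_zero.congr fun n => ?_
  rw [one_div, div_eq_inv_mul]

omit hη in
/-- Summation by parts. -/
lemma sum_inv_mul_sub (d : ℕ → ℝ) (T : ℕ) :
    ∑ t ∈ Finset.range T, (η (t + 1))⁻¹ * (d t - d (t + 1))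
      = (η 0)⁻¹ * d 0 - (η T)⁻¹ * d T
        + ∑ t ∈ Finset.range T, ((η (t + 1))⁻¹ - (η t)⁻¹) * d t := by
  induction T with
  | zero => simp
  | succ T ih => rw [Finset.sum_range_succ, Finset.sum_range_succ, ih]; ring

end StepSize

namespace MDP

/-! ### The noise of the empirical Bellman operator -/

section Noise

variable {S A : Type*} [Fintype S] [Fintype A] [DecidableEq S] (M : MDP S A)

/-- The noise `α (r_t - r)(x) + γ (P̂_t - P) v (x)` produced by one sample, for a value vector `v`
and with the reward noise weighted by `α`. -/
noncomputable def sampleNoise (α : ℝ) (v : S → ℝ) (ξ : Sample S A) (x : S × A) : ℝ :=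
  α * ((ξ x).1 - M.r x)
    + M.γ * ∑ s', ((if (ξ x).2 = s' then 1 else 0) - (M.P x s').toReal) * v s'

lemma sampleNoise_eq (α : ℝ) (v : S → ℝ) (ξ : Sample S A) (x : S × A) :
    M.sampleNoise α v ξ x
      = α * ((ξ x).1 - M.r x) + M.γ * (v (ξ x).2 - ∑ s', (M.P x s').toReal * v s') := by
  simp [sampleNoise, sub_mul, Finset.sum_sub_distrib]

lemma empBellman_eq (ξ : Sample S A) (Q : S × A → ℝ) (x : S × A) :
    M.empBellman ξ Q x = M.bellman Q x + M.sampleNoise 1 (greedyValue Q) ξ x := by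
  rw [sampleNoise_eq, empBellman, bellman]; ring

lemma sampleNoise_add (α β : ℝ) (v w : S → ℝ) (ξ : Sample S A) (x : S × A) :
    M.sampleNoise (α + β) (fun s => v s + w s) ξ x
      = M.sampleNoise α v ξ x + M.sampleNoise β w ξ x := by
  simp only [sampleNoise_eq, mul_add, Finset.sum_add_distrib]; ring

lemma abs_sampleNoise_le (α : ℝ) {v : S → ℝ} {c : ℝ} (hv : ∀ s, |v s| ≤ c) (ξ : Sample S A)
    (x : S × A) : |M.sampleNoise α v ξ x| ≤ |α| * |(ξ x).1 - M.r x| + 2 * c := by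
  rw [sampleNoise_eq]
  refine (abs_add_le _ _).trans ?_
  rw [abs_mul, abs_mul, abs_of_pos M.γ_pos]
  have h1 := (abs_sub (v (ξ x).2) (∑ s', (M.P x s').toReal * v s')).trans
    (add_le_add (hv _) (abs_sum_toReal_pmf_mul_le (M.P x) hv))
  have h2 : 0 ≤ c := (abs_nonneg _).trans (hv (ξ x).2)
  have h3 := M.γ_lt_one
  have h4 := M.γ_pos
  have h5 : M.γ * |v (ξ x).2 - ∑ s', (M.P x s').toReal * v s'| ≤ 1 * (c + c) := by gcongr
  linarith

lemma abs_bellman_sub_le (Q Q' : S × A → ℝ) (x : S × A) :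
    |M.bellman Q x - M.bellman Q' x| ≤ M.γ * ‖Q - Q'‖ := by
  rw [bellman, bellman, add_sub_add_left_eq_sub, ← mul_sub, ← Finset.sum_sub_distrib, abs_mul,
    abs_of_pos M.γ_pos]
  simp_rw [← mul_sub]
  exact mul_le_mul_of_nonneg_left
    (abs_sum_toReal_pmf_mul_le _ fun s => abs_greedyValue_sub_le Q Q' s) M.γ_pos.le

variable [MeasurableSpace S] [MeasurableSingletonClass S]

lemma bellmanNoise_eq [MeasurableSpace A] [MeasurableSingletonClass A]
    (ξ : Sample S A) (x : S × A) :
    M.bellmanNoise ξ x = M.sampleNoise 1 (greedyValue M.Qstar) ξ x := by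
  rw [bellmanNoise, empBellman_eq, add_sub_cancel_left]

lemma measurable_sampleNoise (α : ℝ) (x : S × A) :
    Measurable fun p : Sample S A × (S → ℝ) => M.sampleNoise α p.2 p.1 x := by
  have h : ∀ s' : S, Measurable fun p : Sample S A × (S → ℝ) =>
      if (p.1 x).2 = s' then (1 : ℝ) else 0 := fun s' =>
    Measurable.ite ((measurableSet_singleton s').preimage (by fun_prop)) measurable_const
      measurable_const
  unfold sampleNoise
  fun_prop

lemma measurable_greedyValue (s : S) :
    Measurable fun Q : S × A → ℝ => greedyValue Q s := by
  unfold greedyValue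
  exact Measurable.iSup fun a => measurable_pi_apply _

lemma measurable_greedyValue_pi :
    Measurable fun Q : S × A → ℝ => (greedyValue Q : S → ℝ) :=
  measurable_pi_iff.2 measurable_greedyValue

lemma measurable_bellman (x : S × A) : Measurable fun Q : S × A → ℝ => M.bellman Q x := by
  have := measurable_greedyValue (S := S) (A := A)
  unfold bellman
  fun_prop

lemma measurable_empBellman (x : S × A) :
    Measurable fun p : Sample S A × (S × A → ℝ) => M.empBellman p.1 p.2 x := by
  simp_rw [empBellman_eq]
  exact ((M.measurable_bellman x).comp measurable_snd).add ((M.measurable_sampleNoise 1 x).comp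
    (measurable_fst.prodMk (measurable_greedyValue_pi.comp measurable_snd)))

instance : IsProbabilityMeasure (M.sampleLaw (S := S) (A := A)) := by
  unfold sampleLaw; infer_instance

lemma memLp_id_reward (hR : M.FourthMoment) (x : S × A) :
    MemLp (fun y : ℝ => y) 2 (M.R x : Measure ℝ) := by
  rw [memLp_two_iff_integrable_sq (by fun_prop)]
  refine ((integrable_const 1).add (hR x)).mono' (by fun_prop) (ae_of_all _ fun y => ?_)
  rw [Real.norm_of_nonneg (sq_nonneg y), Pi.add_apply, ← sq_abs y]
  nlinarith [sq_nonneg (|y| ^ 2 - 1)]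

lemma measurePreserving_eval_sampleLaw (x : S × A) :
    MeasurePreserving (fun ξ : Sample S A => ξ x) M.sampleLaw
      ((M.R x : Measure ℝ).prod (M.P x).toMeasure) :=
  measurePreserving_eval _ x

lemma measurePreserving_reward (x : S × A) :
    MeasurePreserving (fun ξ : Sample S A => (ξ x).1) M.sampleLaw (M.R x : Measure ℝ) :=
  measurePreserving_fst.comp (M.measurePreserving_eval_sampleLaw x)

lemma measurePreserving_state (x : S × A) :
    MeasurePreserving (fun ξ : Sample S A => (ξ x).2) M.sampleLaw (M.P x).toMeasure :=
  measurePreserving_snd.comp (M.measurePreserving_eval_sampleLaw x)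

lemma memLp_reward (hR : M.FourthMoment) (x : S × A) :
    MemLp (fun ξ : Sample S A => (ξ x).1) 2 M.sampleLaw :=
  (M.memLp_id_reward hR x).comp_measurePreserving (M.measurePreserving_reward x)

lemma memLp_sampleNoise (hR : M.FourthMoment) (α : ℝ) (v : S → ℝ) (x : S × A) :
    MemLp (fun ξ => M.sampleNoise α v ξ x) 2 M.sampleLaw := by
  refine MemLp.mono' (g := fun ξ => |α| * |(ξ x).1 - M.r x| + 2 * ‖v‖) ?_
    ((M.measurable_sampleNoise α x).comp (measurable_id.prodMk measurable_const)).aestronglyMeasurable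
    (ae_of_all _ fun ξ => M.abs_sampleNoise_le α (fun s => norm_le_pi_norm v s) ξ x)
  exact ((((M.memLp_reward hR x).sub (memLp_const _)).abs).const_mul _).add (memLp_const _)

lemma integral_sampleNoise (hR : M.FourthMoment) (α : ℝ) (v : S → ℝ) (x : S × A) :
    ∫ ξ, M.sampleNoise α v ξ x ∂M.sampleLaw = 0 := by
  have h1 : ∫ ξ : Sample S A, (ξ x).1 ∂M.sampleLaw = M.r x := by
    rw [r, ← (M.measurePreserving_reward x).map_eq,
      integral_map (M.measurePreserving_reward x).aemeasurable (by fun_prop)]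
  have hm : Measurable v := Measurable.of_discrete
  have h2 : ∫ ξ : Sample S A, v (ξ x).2 ∂M.sampleLaw = ∑ s', (M.P x s').toReal * v s' := by
    have h3 : ∫ s', v s' ∂(M.P x).toMeasure = ∑ s', (M.P x s').toReal * v s' := by
      rw [PMF.integral_eq_sum]; rfl
    rw [← h3, ← (M.measurePreserving_state x).map_eq,
      integral_map (M.measurePreserving_state x).aemeasurable hm.aestronglyMeasurable]
  have i1 := (M.memLp_reward hR x).integrable one_le_two
  have i2 : Integrable (fun ξ : Sample S A => v (ξ x).2) M.sampleLaw :=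
    Integrable.of_bound
      (hm.comp (M.measurePreserving_state x).measurable).aestronglyMeasurable ‖v‖
      (ae_of_all _ fun ξ => norm_le_pi_norm v _)
  have j1 : Integrable (fun ξ : Sample S A => α * ((ξ x).1 - M.r x)) M.sampleLaw :=
    (i1.sub (integrable_const _)).const_mul α
  have j2 : Integrable (fun ξ : Sample S A =>
      M.γ * (v (ξ x).2 - ∑ s', (M.P x s').toReal * v s')) M.sampleLaw :=
    (i2.sub (integrable_const _)).const_mul _
  simp_rw [sampleNoise_eq]
  rw [integral_add j1 j2, integral_const_mul, integral_const_mul,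
    integral_sub i1 (integrable_const _), integral_sub i2 (integrable_const _), h1, h2]
  simp

end Noise

/-! ### Observations of the past -/

section Past

variable {S A : Type*} [Fintype S] [Fintype A] [DecidableEq S] [MeasurableSpace S]
  [MeasurableSingletonClass S] {M : MDP S A} {Ω : Type*}

/-- The σ-algebra generated by the observations of the iterations `1, …, t`. -/
@[reducible]
def past (ξ : ℕ → Ω → Sample S A) (t : ℕ) : MeasurableSpace Ω :=
  ⨆ i ∈ Set.Iio t, MeasurableSpace.comap (ξ (i + 1)) inferInstance

lemma past_mono (ξ : ℕ → Ω → Sample S A) {s t : ℕ} (h : s ≤ t) : past ξ s ≤ past ξ t :=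
  biSup_mono fun _ hi => lt_of_lt_of_le hi h

lemma measurable_past (ξ : ℕ → Ω → Sample S A) (t : ℕ) :
    Measurable[past ξ (t + 1)] (ξ (t + 1)) := by
  have h : MeasurableSpace.comap (ξ (t + 1)) inferInstance ≤ past ξ (t + 1) :=
    le_biSup (fun i => MeasurableSpace.comap (ξ (i + 1)) inferInstance)
      (show t ∈ Set.Iio (t + 1) from Nat.lt_succ_self t)
  exact (comap_measurable (ξ (t + 1))).mono h le_rfl

variable [mΩ : MeasurableSpace Ω] {μ : Measure Ω} {ξ : ℕ → Ω → Sample S A}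

lemma IsGenerative.past_le (hξ : M.IsGenerative μ ξ) (t : ℕ) : past ξ t ≤ mΩ :=
  iSup₂_le fun i _ => (hξ.measurable (i + 1) (Nat.le_add_left 1 i)).comap_le

lemma IsGenerative.measurable_succ (hξ : M.IsGenerative μ ξ) (t : ℕ) : Measurable (ξ (t + 1)) :=
  hξ.measurable (t + 1) (Nat.le_add_left 1 t)

lemma IsGenerative.measurePreserving (hξ : M.IsGenerative μ ξ) (t : ℕ) :
    MeasurePreserving (ξ (t + 1)) μ M.sampleLaw :=
  ⟨hξ.measurable_succ t, hξ.law (t + 1) (Nat.le_add_left 1 t)⟩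

lemma IsGenerative.integral_comp (hξ : M.IsGenerative μ ξ) (t : ℕ) {g : Sample S A → ℝ}
    (hg : Measurable g) : ∫ ω, g (ξ (t + 1) ω) ∂μ = ∫ z, g z ∂M.sampleLaw := by
  rw [← (hξ.measurePreserving t).map_eq,
    integral_map (hξ.measurable_succ t).aemeasurable hg.aestronglyMeasurable]

lemma IsGenerative.indepFun_past (hξ : M.IsGenerative μ ξ) {t : ℕ} {U : Ω → ℝ}
    (hU : Measurable[past ξ t] U) {g : Sample S A → ℝ} (hg : Measurable g) :
    IndepFun U (fun ω => g (ξ (t + 1) ω)) μ := by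
  have h := indep_iSup_of_disjoint (fun i => (hξ.measurable_succ i).comap_le) hξ.indep.iIndep
    (S := Set.Iio t) (T := {t}) (by simp)
  rw [IndepFun_iff_Indep]
  refine indep_of_indep_of_le_left (indep_of_indep_of_le_right h ?_) hU.comap_le
  simp only [Set.mem_singleton_iff, iSup_iSup_eq_left]
  change MeasurableSpace.comap (g ∘ ξ (t + 1)) _ ≤ _
  rw [← MeasurableSpace.comap_comp]
  exact MeasurableSpace.comap_mono hg.comap_le

/-- Fresh centered noise is orthogonal to the past. -/
lemma IsGenerative.integral_mul_eq_zero (hξ : M.IsGenerative μ ξ) {t : ℕ} {U : Ω → ℝ}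
    (hU : Measurable[past ξ t] U) {g : Sample S A → ℝ} (hg : Measurable g)
    (h0 : ∫ z, g z ∂M.sampleLaw = 0) : ∫ ω, U ω * g (ξ (t + 1) ω) ∂μ = 0 := by
  rw [(hξ.indepFun_past hU hg).integral_fun_mul_eq_mul_integral
    (hU.mono (hξ.past_le t) le_rfl).aestronglyMeasurable
    (hg.comp (hξ.measurable_succ t)).aestronglyMeasurable, hξ.integral_comp t hg, h0, mul_zero]

variable [IsProbabilityMeasure μ]

lemma IsGenerative.memLp_sampleNoise (hξ : M.IsGenerative μ ξ) (hR : M.FourthMoment) {t : ℕ}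
    (α : ℝ) {v : Ω → S → ℝ} (hv : ∀ s, MemLp (fun ω => v ω s) 2 μ) (x : S × A)
    (hvm : Measurable v) :
    MemLp (fun ω => M.sampleNoise α (v ω) (ξ (t + 1) ω) x) 2 μ := by
  refine MemLp.mono' (g := fun ω => |α| * |(ξ (t + 1) ω x).1 - M.r x| + 2 * ‖v ω‖) ?_
    ((M.measurable_sampleNoise α x).comp
      ((hξ.measurable_succ t).prodMk hvm)).aestronglyMeasurable
    (ae_of_all _ fun ω => M.abs_sampleNoise_le α (fun s => norm_le_pi_norm (v ω) s) _ x)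
  have h1 : MemLp (fun ω => (ξ (t + 1) ω x).1) 2 μ :=
    (M.memLp_reward hR x).comp_measurePreserving (hξ.measurePreserving t)
  exact (((h1.sub (memLp_const _)).abs).const_mul _).add ((MemLp.of_eval hv).norm.const_mul 2)

/-- The noise of iteration `t + 1`, for a value vector depending on the past, is orthogonal to the
past. -/
lemma IsGenerative.integral_mul_sampleNoise (hξ : M.IsGenerative μ ξ) (hR : M.FourthMoment)
    {t : ℕ} (α : ℝ) {U : Ω → ℝ} (hU : Measurable[past ξ t] U) (hU2 : MemLp U 2 μ)
    {v : Ω → S → ℝ} (hvm : Measurable[past ξ t] v) (hv : ∀ s, MemLp (fun ω => v ω s) 2 μ)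
    (x : S × A) : ∫ ω, U ω * M.sampleNoise α (v ω) (ξ (t + 1) ω) x ∂μ = 0 := by
  have hpast := hξ.past_le t
  -- The noise is a finite sum of products of a past variable and a centered function of the fresh
  -- sample, so independence applies to each product.
  set g : S → Sample S A → ℝ := fun s z => (if (z x).2 = s then 1 else 0) - (M.P x s).toReal
    with hg
  have hgm : ∀ s, Measurable (g s) := fun s =>
    (Measurable.ite ((measurableSet_singleton s).preimage (by fun_prop)) measurable_const
      measurable_const).sub measurable_const
  have hg1 : ∀ s z, |g s z| ≤ 1 := by
    intro s z
    have h1 : (M.P x s).toReal ≤ 1 := ENNReal.toReal_le_of_le_ofReal zero_le_one (by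
      simpa using (M.P x).coe_le_one s)
    have h0 : 0 ≤ (M.P x s).toReal := ENNReal.toReal_nonneg
    rw [hg, abs_le]
    dsimp only
    split_ifs <;> constructor <;> linarith
  have hg0 : ∀ s, ∫ z, g s z ∂M.sampleLaw = 0 := by
    intro s
    -- The centering of `g s` is that of the noise for the indicator of `s`.
    have h := M.integral_sampleNoise hR 0 (Pi.single s 1) x
    simp only [sampleNoise, zero_mul, zero_add, Pi.single_apply, mul_ite, mul_one, mul_zero,
      Finset.sum_ite_eq', Finset.mem_univ, if_true] at h
    rw [integral_const_mul] at h
    exact (mul_eq_zero.1 h).resolve_left M.γ_pos.ne'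
  have hr0 : ∫ z : Sample S A, ((z x).1 - M.r x) ∂M.sampleLaw = 0 := by
    have h := M.integral_sampleNoise hR 1 0 x
    simpa [sampleNoise] using h
  have hvs : ∀ s, Measurable[past ξ t] fun ω => v ω s := fun s => (measurable_pi_apply s).comp hvm
  have hUv : ∀ s, Measurable[past ξ t] fun ω => U ω * v ω s := fun s => hU.mul (hvs s)
  have e : ∀ ω, U ω * M.sampleNoise α (v ω) (ξ (t + 1) ω) x
      = α * (U ω * ((ξ (t + 1) ω x).1 - M.r x))
        + M.γ * ∑ s, U ω * v ω s * g s (ξ (t + 1) ω) := by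
    intro ω
    rw [sampleNoise, mul_add, Finset.mul_sum, Finset.mul_sum, Finset.mul_sum]
    congr 1
    · ring
    · exact Finset.sum_congr rfl fun s _ => by simp only [hg]; ring
  have i1 : Integrable (fun ω => U ω * ((ξ (t + 1) ω x).1 - M.r x)) μ :=
    hU2.integrable_mul (((M.memLp_reward hR x).comp_measurePreserving
      (hξ.measurePreserving t)).sub (memLp_const _))
  have i2 : ∀ s, Integrable (fun ω => U ω * v ω s * g s (ξ (t + 1) ω)) μ := by
    intro s
    refine (hU2.integrable_mul (hv s)).mono
      (((hUv s).mono hpast le_rfl).mul ((hgm s).comp (hξ.measurable_succ t))).aestronglyMeasurable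
      (ae_of_all _ fun ω => ?_)
    rw [norm_mul]
    exact mul_le_of_le_one_right (norm_nonneg _) (hg1 s _)
  simp_rw [e]
  rw [integral_add (i1.const_mul _) ((integrable_finsetSum _ fun s _ => i2 s).const_mul _),
    integral_const_mul, integral_const_mul, integral_finsetSum _ fun s _ => i2 s,
    hξ.integral_mul_eq_zero hU (g := fun z => (z x).1 - M.r x) (by fun_prop) hr0,
    Finset.sum_eq_zero fun s _ => hξ.integral_mul_eq_zero (hUv s) (hgm s) (hg0 s)]
  simp

/-- Pythagoras for a past variable and a fresh noise. -/
lemma IsGenerative.integral_sq_add_sampleNoise (hξ : M.IsGenerative μ ξ) (hR : M.FourthMoment)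
    {t : ℕ} (α a b : ℝ) {U : Ω → ℝ} (hU : Measurable[past ξ t] U) (hU2 : MemLp U 2 μ)
    {v : Ω → S → ℝ} (hvm : Measurable[past ξ t] v) (hv : ∀ s, MemLp (fun ω => v ω s) 2 μ)
    (x : S × A) :
    ∫ ω, (a * U ω + b * M.sampleNoise α (v ω) (ξ (t + 1) ω) x) ^ 2 ∂μ
      = a ^ 2 * ∫ ω, U ω ^ 2 ∂μ
        + b ^ 2 * ∫ ω, M.sampleNoise α (v ω) (ξ (t + 1) ω) x ^ 2 ∂μ := by
  have hN : MemLp (fun ω => M.sampleNoise α (v ω) (ξ (t + 1) ω) x) 2 μ :=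
    hξ.memLp_sampleNoise hR α hv x (hvm.mono (hξ.past_le t) le_rfl)
  have e : ∀ ω, (a * U ω + b * M.sampleNoise α (v ω) (ξ (t + 1) ω) x) ^ 2
      = a ^ 2 * U ω ^ 2 + b ^ 2 * M.sampleNoise α (v ω) (ξ (t + 1) ω) x ^ 2
        + 2 * a * b * (U ω * M.sampleNoise α (v ω) (ξ (t + 1) ω) x) := fun ω => by ring
  simp_rw [e]
  have iU := hU2.integrable_sq.const_mul (a ^ 2)
  have iN := hN.integrable_sq.const_mul (b ^ 2)
  have iUN : Integrable (fun ω => 2 * a * b * (U ω * M.sampleNoise α (v ω) (ξ (t + 1) ω) x)) μ :=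
    (hU2.integrable_mul hN).const_mul (2 * a * b)
  have iS : Integrable (fun ω => a ^ 2 * U ω ^ 2
      + b ^ 2 * M.sampleNoise α (v ω) (ξ (t + 1) ω) x ^ 2) μ := iU.add iN
  rw [integral_add iS iUN, integral_add iU iN, integral_const_mul, integral_const_mul,
    integral_const_mul, hξ.integral_mul_sampleNoise hR α hU hU2 hvm hv x, mul_zero, add_zero]

end Past
end MDP

/-- Convexity of the square. -/
lemma sq_le_of_le_convexComb {a b d θ : ℝ} (h0 : 0 ≤ θ) (h1 : θ ≤ 1) (hd : 0 ≤ d)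
    (h : d ≤ (1 - θ) * a + θ * b) : d ^ 2 ≤ (1 - θ) * a ^ 2 + θ * b ^ 2 := by
  have h2 : d ^ 2 ≤ ((1 - θ) * a + θ * b) ^ 2 := pow_le_pow_left₀ hd h 2
  nlinarith [mul_nonneg (mul_nonneg h0 (sub_nonneg.2 h1)) (sq_nonneg (a - b))]

namespace MDP

/-! ### Mean-square rate of the iterates -/

section Rate

variable {S A : Type*} [Fintype S] [Fintype A] [DecidableEq S] [MeasurableSpace S]
  [MeasurableSingletonClass S] {M : MDP S A} {Ω : Type*}

lemma iterate_succ (η : ℕ → ℝ) (Q₀ : S × A → ℝ) (ξ : ℕ → Sample S A) (t : ℕ) (x : S × A) :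
    M.iterate η Q₀ ξ (t + 1) x = (1 - η (t + 1)) * M.iterate η Q₀ ξ t x
      + η (t + 1) * M.empBellman (ξ (t + 1)) (M.iterate η Q₀ ξ t) x := rfl

variable (M) in
/-- The noise process `X_0 = 0`, `X_{t+1} = (1 - η_{t+1}) X_t + η_{t+1} (T̂_{t+1} - T) Q_t` of
Q-learning: the exponential average of the Bellman noises met so far. -/
noncomputable def noiseAvg (η : ℕ → ℝ) (Q₀ : S × A → ℝ) (ξ : ℕ → Sample S A) :
    ℕ → S × A → ℝ
  | 0 => 0
  | t + 1 => fun x => (1 - η (t + 1)) * noiseAvg η Q₀ ξ t x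
      + η (t + 1) * M.sampleNoise 1 (greedyValue (M.iterate η Q₀ ξ t)) (ξ (t + 1)) x

lemma noiseAvg_succ (η : ℕ → ℝ) (Q₀ : S × A → ℝ) (ξ : ℕ → Sample S A) (t : ℕ) (x : S × A) :
    M.noiseAvg η Q₀ ξ (t + 1) x = (1 - η (t + 1)) * M.noiseAvg η Q₀ ξ t x
      + η (t + 1) * M.sampleNoise 1 (greedyValue (M.iterate η Q₀ ξ t)) (ξ (t + 1)) x := rfl

lemma measurable_iterate (η : ℕ → ℝ) (Q₀ : S × A → ℝ) (ξ : ℕ → Ω → Sample S A) (t : ℕ) :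
    Measurable[past ξ t] fun ω => M.iterate η Q₀ (fun i => ξ i ω) t := by
  induction t with
  | zero => exact measurable_const
  | succ t ih =>
    have ih' := ih.mono (past_mono ξ (Nat.le_succ t)) le_rfl
    have hE : ∀ x, Measurable[past ξ (t + 1)] fun ω =>
        M.empBellman (ξ (t + 1) ω) (M.iterate η Q₀ (fun i => ξ i ω) t) x :=
      fun x => (M.measurable_empBellman x).comp ((measurable_past ξ t).prodMk ih')
    let _ : MeasurableSpace Ω := past ξ (t + 1)
    refine measurable_pi_iff.2 fun x => ?_
    simp_rw [iterate_succ]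
    exact (((measurable_pi_apply x).comp ih').const_mul _).add ((hE x).const_mul _)

lemma measurable_noiseAvg (η : ℕ → ℝ) (Q₀ : S × A → ℝ) (ξ : ℕ → Ω → Sample S A) (t : ℕ) :
    Measurable[past ξ t] fun ω => M.noiseAvg η Q₀ (fun i => ξ i ω) t := by
  induction t with
  | zero => exact measurable_const
  | succ t ih =>
    have ih' := ih.mono (past_mono ξ (Nat.le_succ t)) le_rfl
    have hQ := (measurable_iterate (M := M) η Q₀ ξ t).mono (past_mono ξ (Nat.le_succ t)) le_rfl
    have hE : ∀ x, Measurable[past ξ (t + 1)] fun ω => M.sampleNoise 1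
        (greedyValue (M.iterate η Q₀ (fun i => ξ i ω) t)) (ξ (t + 1) ω) x :=
      fun x => (M.measurable_sampleNoise 1 x).comp
        ((measurable_past ξ t).prodMk (measurable_greedyValue_pi.comp hQ))
    let _ : MeasurableSpace Ω := past ξ (t + 1)
    refine measurable_pi_iff.2 fun x => ?_
    simp_rw [noiseAvg_succ]
    exact (((measurable_pi_apply x).comp ih').const_mul _).add ((hE x).const_mul _)

variable [mΩ : MeasurableSpace Ω] {μ : Measure Ω} [IsProbabilityMeasure μ]
  {ξ : ℕ → Ω → Sample S A}

lemma memLp_greedyValue {Q : Ω → S × A → ℝ} (hQ : MemLp Q 2 μ) :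
    MemLp (fun ω => (greedyValue (Q ω) : S → ℝ)) 2 μ :=
  hQ.norm.mono' (measurable_greedyValue_pi.comp_aemeasurable
      hQ.aestronglyMeasurable.aemeasurable).aestronglyMeasurable
    (ae_of_all _ fun ω => (pi_norm_le_iff_of_nonneg (norm_nonneg _)).2 fun s =>
      abs_greedyValue_le (Q ω) s)

variable (M) in
lemma memLp_bellman {Q : Ω → S × A → ℝ} (hQ : MemLp Q 2 μ) (x : S × A) :
    MemLp (fun ω => M.bellman (Q ω) x) 2 μ := by
  have h : ∀ s, MemLp (fun ω => (M.P x s).toReal * greedyValue (Q ω) s) 2 μ :=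
    fun s => ((memLp_greedyValue hQ).eval s).const_mul _
  have h2 : MemLp (fun ω => ∑ s, (M.P x s).toReal * greedyValue (Q ω) s) 2 μ :=
    memLp_finsetSum _ fun s _ => h s
  exact (memLp_const (M.r x)).add (h2.const_mul M.γ)

lemma IsGenerative.memLp_iterate (hξ : M.IsGenerative μ ξ) (hR : M.FourthMoment) (η : ℕ → ℝ)
    (Q₀ : S × A → ℝ) (t : ℕ) : MemLp (fun ω => M.iterate η Q₀ (fun i => ξ i ω) t) 2 μ := by
  induction t with
  | zero => exact memLp_const _
  | succ t ih =>
    refine MemLp.of_eval fun x => ?_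
    simp_rw [iterate_succ, empBellman_eq]
    have hm := (measurable_iterate (M := M) η Q₀ ξ t).mono (hξ.past_le t) le_rfl
    exact ((ih.eval x).const_mul _).add (((M.memLp_bellman ih x).add
      (hξ.memLp_sampleNoise hR 1 (fun s => (memLp_greedyValue ih).eval s) x
        (measurable_greedyValue_pi.comp hm))).const_mul _)

lemma IsGenerative.memLp_noiseAvg (hξ : M.IsGenerative μ ξ) (hR : M.FourthMoment) (η : ℕ → ℝ)
    (Q₀ : S × A → ℝ) (t : ℕ) : MemLp (fun ω => M.noiseAvg η Q₀ (fun i => ξ i ω) t) 2 μ := by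
  induction t with
  | zero => exact memLp_const _
  | succ t ih =>
    refine MemLp.of_eval fun x => ?_
    simp_rw [noiseAvg_succ]
    have hm := (measurable_iterate (M := M) η Q₀ ξ t).mono (hξ.past_le t) le_rfl
    exact ((ih.eval x).const_mul _).add ((hξ.memLp_sampleNoise hR 1
      (fun s => (memLp_greedyValue (hξ.memLp_iterate hR η Q₀ t)).eval s) x
        (measurable_greedyValue_pi.comp hm)).const_mul _)

lemma IsGenerative.memLp_rewards (hξ : M.IsGenerative μ ξ) (hR : M.FourthMoment) (t : ℕ) :
    MemLp (fun ω x => (ξ (t + 1) ω x).1) 2 μ :=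
  MemLp.of_eval fun x =>
    (M.memLp_reward hR x).comp_measurePreserving (hξ.measurePreserving t)

lemma IsGenerative.integral_rewards (hξ : M.IsGenerative μ ξ) (t : ℕ) :
    ∫ ω, ‖fun x => (ξ (t + 1) ω x).1‖ ^ 2 ∂μ
      = ∫ z : Sample S A, ‖fun x => (z x).1‖ ^ 2 ∂M.sampleLaw :=
  hξ.integral_comp t (g := fun z => ‖fun x => (z x).1‖ ^ 2) (by fun_prop)

variable {η : ℕ → ℝ}

/-- The second moments of the iterates stay bounded, because
`‖Q_{t+1}‖ ≤ (1 - (1 - γ) η_{t+1}) ‖Q_t‖ + η_{t+1} ‖r_{t+1}‖`. -/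
lemma IsGenerative.exists_integral_iterate_le (hξ : M.IsGenerative μ ξ) (hR : M.FourthMoment)
    (hη : StepSize η) (Q₀ : S × A → ℝ) :
    ∃ B : ℝ, ∀ t, ∫ ω, ‖M.iterate η Q₀ (fun i => ξ i ω) t‖ ^ 2 ∂μ ≤ B := by
  obtain ⟨c, hc⟩ : ∃ c, c = 1 - M.γ := ⟨_, rfl⟩
  have hγc : M.γ = 1 - c := by linarith
  have hc0 : 0 < c := by linarith [M.γ_lt_one]
  have hc1 : c ≤ 1 := by have := M.γ_pos; linarith
  set ρ := ∫ z : Sample S A, ‖fun x => (z x).1‖ ^ 2 ∂M.sampleLaw with hρ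
  -- The step is a convex combination of `‖Q_t‖` and `‖r_{t+1}‖ / c`.
  refine ⟨max (‖Q₀‖ ^ 2) (ρ / c ^ 2), fun t => ?_⟩
  induction t with
  | zero => simp [iterate]
  | succ t ih =>
    have hp := hη.pos (t + 1)
    have hθ0 : 0 ≤ c * η (t + 1) := by positivity
    have hθ1 : c * η (t + 1) ≤ 1 := by nlinarith [hη.le_one (t + 1)]
    have hpt : ∀ ω, ‖M.iterate η Q₀ (fun i => ξ i ω) (t + 1)‖ ^ 2
        ≤ (1 - c * η (t + 1)) * ‖M.iterate η Q₀ (fun i => ξ i ω) t‖ ^ 2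
          + c * η (t + 1) * (‖fun x => (ξ (t + 1) ω x).1‖ / c) ^ 2 := by
      intro ω
      refine sq_le_of_le_convexComb hθ0 hθ1 (norm_nonneg _) ?_
      have e : (1 - c * η (t + 1)) * ‖M.iterate η Q₀ (fun i => ξ i ω) t‖
          + c * η (t + 1) * (‖fun x => (ξ (t + 1) ω x).1‖ / c)
          = (1 - η (t + 1)) * ‖M.iterate η Q₀ (fun i => ξ i ω) t‖
            + η (t + 1) * (‖fun x => (ξ (t + 1) ω x).1‖
              + M.γ * ‖M.iterate η Q₀ (fun i => ξ i ω) t‖) := by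
        rw [hγc]; field_simp; ring
      have hη1 : 0 ≤ 1 - η (t + 1) := sub_nonneg.2 (hη.le_one _)
      have hγ := M.γ_pos.le
      rw [e, pi_norm_le_iff_of_nonneg (by positivity)]
      intro x
      rw [iterate_succ, Real.norm_eq_abs, empBellman]
      refine (abs_add_le _ _).trans (add_le_add ?_ ?_)
      · rw [abs_mul, abs_of_nonneg hη1]
        exact mul_le_mul_of_nonneg_left (norm_le_pi_norm (M.iterate η Q₀ _ t) x) hη1
      · rw [abs_mul, abs_of_pos hp]
        refine mul_le_mul_of_nonneg_left ((abs_add_le _ _).trans (add_le_add ?_ ?_)) hp.le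
        · exact norm_le_pi_norm (fun x => (ξ (t + 1) ω x).1) x
        · rw [abs_mul, abs_of_nonneg hγ]
          exact mul_le_mul_of_nonneg_left (abs_greedyValue_le _ _) hγ
    have i1 := ((hξ.memLp_iterate hR η Q₀ t).norm.integrable_sq).const_mul (1 - c * η (t + 1))
    have i2 : Integrable (fun ω => c * η (t + 1) * (‖fun x => (ξ (t + 1) ω x).1‖ / c) ^ 2) μ := by
      simp_rw [div_pow]
      exact ((hξ.memLp_rewards hR t).norm.integrable_sq.div_const _).const_mul _
    calc _ ≤ ∫ ω, ((1 - c * η (t + 1)) * ‖M.iterate η Q₀ (fun i => ξ i ω) t‖ ^ 2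
          + c * η (t + 1) * (‖fun x => (ξ (t + 1) ω x).1‖ / c) ^ 2) ∂μ :=
          integral_mono (hξ.memLp_iterate hR η Q₀ (t + 1)).norm.integrable_sq (i1.add i2) hpt
      _ = (1 - c * η (t + 1)) * ∫ ω, ‖M.iterate η Q₀ (fun i => ξ i ω) t‖ ^ 2 ∂μ
          + c * η (t + 1) * (ρ / c ^ 2) := by
          rw [integral_add i1 i2, integral_const_mul, integral_const_mul]
          simp_rw [div_pow]
          rw [integral_div, hξ.integral_rewards]
      _ ≤ (1 - c * η (t + 1)) * max (‖Q₀‖ ^ 2) (ρ / c ^ 2)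
          + c * η (t + 1) * max (‖Q₀‖ ^ 2) (ρ / c ^ 2) := by
          refine add_le_add (mul_le_mul_of_nonneg_left ih (by linarith))
            (mul_le_mul_of_nonneg_left (le_max_right _ _) hθ0)
      _ = _ := by ring

/-- The noise process has second moments of the order of the step size. -/
lemma IsGenerative.exists_integral_noiseAvg_le (hξ : M.IsGenerative μ ξ) (hR : M.FourthMoment)
    (hη : StepSize η) (Q₀ : S × A → ℝ) :
    ∃ C : ℝ, 0 ≤ C ∧ ∀ t, ∫ ω, ‖M.noiseAvg η Q₀ (fun i => ξ i ω) t‖ ^ 2 ∂μ ≤ C * η t := by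
  obtain ⟨B, hB⟩ := hξ.exists_integral_iterate_le hR hη Q₀
  have hB0 : 0 ≤ B := (integral_nonneg fun ω => sq_nonneg _).trans (hB 0)
  have hcoord : ∀ x : S × A, ∃ C : ℝ, 0 ≤ C ∧
      ∀ t, ∫ ω, M.noiseAvg η Q₀ (fun i => ξ i ω) t x ^ 2 ∂μ ≤ C * η t := by
    intro x
    set V := ∫ z : Sample S A, ((z x).1 - M.r x) ^ 2 ∂M.sampleLaw with hV
    have hV0 : 0 ≤ V := integral_nonneg fun z => sq_nonneg _
    refine hη.exists_le_mul_of_recursion one_pos le_rfl (K := 2 * V + 8 * B) (by positivity)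
      fun t => ?_
    have hQm := measurable_iterate (M := M) η Q₀ ξ t
    have hQ2 := hξ.memLp_iterate hR η Q₀ t
    have hN2 : MemLp (fun ω => M.sampleNoise 1 (greedyValue (M.iterate η Q₀ (fun i => ξ i ω) t))
        (ξ (t + 1) ω) x) 2 μ :=
      hξ.memLp_sampleNoise hR 1 (fun s => (memLp_greedyValue hQ2).eval s) x
        (measurable_greedyValue_pi.comp (hQm.mono (hξ.past_le t) le_rfl))
    have hNle : ∫ ω, M.sampleNoise 1 (greedyValue (M.iterate η Q₀ (fun i => ξ i ω) t))
        (ξ (t + 1) ω) x ^ 2 ∂μ ≤ 2 * V + 8 * B := by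
      have i1 : Integrable (fun ω => 2 * ((ξ (t + 1) ω x).1 - M.r x) ^ 2) μ :=
        ((((hξ.memLp_rewards hR t).eval x).sub (memLp_const _)).integrable_sq).const_mul 2
      have i2 : Integrable (fun ω => 8 * ‖M.iterate η Q₀ (fun i => ξ i ω) t‖ ^ 2) μ :=
        hQ2.norm.integrable_sq.const_mul 8
      calc _ ≤ ∫ ω, (2 * ((ξ (t + 1) ω x).1 - M.r x) ^ 2
            + 8 * ‖M.iterate η Q₀ (fun i => ξ i ω) t‖ ^ 2) ∂μ := by
            refine integral_mono hN2.integrable_sq (i1.add i2) fun ω => ?_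
            have h := M.abs_sampleNoise_le 1
              (fun s => abs_greedyValue_le (M.iterate η Q₀ (fun i => ξ i ω) t) s) (ξ (t + 1) ω) x
            rw [abs_one, one_mul] at h
            have h2 := pow_le_pow_left₀ (abs_nonneg _) h 2
            rw [sq_abs] at h2
            dsimp only
            rw [← sq_abs ((ξ (t + 1) ω x).1 - M.r x)]
            nlinarith [sq_nonneg (|(ξ (t + 1) ω x).1 - M.r x|
              - 2 * ‖M.iterate η Q₀ (fun i => ξ i ω) t‖)]
        _ = 2 * V + 8 * ∫ ω, ‖M.iterate η Q₀ (fun i => ξ i ω) t‖ ^ 2 ∂μ := by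
            rw [integral_add i1 i2, integral_const_mul, integral_const_mul,
              hξ.integral_comp t (g := fun z => ((z x).1 - M.r x) ^ 2) (by fun_prop)]
        _ ≤ _ := by linarith [hB t]
    simp_rw [noiseAvg_succ]
    rw [hξ.integral_sq_add_sampleNoise hR 1 (1 - η (t + 1)) (η (t + 1))
      (U := fun ω => M.noiseAvg η Q₀ (fun i => ξ i ω) t x)
      (v := fun ω => greedyValue (M.iterate η Q₀ (fun i => ξ i ω) t))
      ((measurable_pi_apply x).comp (measurable_noiseAvg (M := M) η Q₀ ξ t))
      ((hξ.memLp_noiseAvg hR η Q₀ t).eval x) (measurable_greedyValue_pi.comp hQm)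
      (fun s => (memLp_greedyValue hQ2).eval s) x]
    have hp := hη.pos (t + 1)
    have h1 := hη.le_one (t + 1)
    have h2 := hη.antitone (Nat.le_succ t)
    have hX0 : 0 ≤ ∫ ω, M.noiseAvg η Q₀ (fun i => ξ i ω) t x ^ 2 ∂μ :=
      integral_nonneg fun ω => sq_nonneg _
    refine add_le_add ?_ ?_
    · exact mul_le_mul_of_nonneg_right (by nlinarith) hX0
    · calc _ ≤ η (t + 1) ^ 2 * (2 * V + 8 * B) := mul_le_mul_of_nonneg_left hNle (sq_nonneg _)
        _ = (2 * V + 8 * B) * η (t + 1) * η (t + 1) := by ring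
        _ ≤ _ := mul_le_mul_of_nonneg_left h2 (by positivity)
  choose C hC0 hC using hcoord
  refine ⟨∑ x, C x, Finset.sum_nonneg fun x _ => hC0 x, fun t => ?_⟩
  have hX := hξ.memLp_noiseAvg hR η Q₀ t
  have hi : ∀ x, Integrable (fun ω => M.noiseAvg η Q₀ (fun i => ξ i ω) t x ^ 2) μ :=
    fun x => (hX.eval x).integrable_sq
  calc _ ≤ ∫ ω, ∑ x, M.noiseAvg η Q₀ (fun i => ξ i ω) t x ^ 2 ∂μ := by
        refine integral_mono hX.norm.integrable_sq (integrable_finsetSum _ fun x _ => hi x)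
          fun ω => ?_
        have h0 : 0 ≤ ∑ x, M.noiseAvg η Q₀ (fun i => ξ i ω) t x ^ 2 :=
          Finset.sum_nonneg fun x _ => sq_nonneg _
        rw [← Real.le_sqrt (norm_nonneg _) h0, pi_norm_le_iff_of_nonneg (Real.sqrt_nonneg _)]
        intro x
        rw [Real.norm_eq_abs]
        exact Real.abs_le_sqrt (Finset.single_le_sum
          (f := fun x => M.noiseAvg η Q₀ (fun i => ξ i ω) t x ^ 2)
          (fun x _ => sq_nonneg _) (Finset.mem_univ x))
    _ = ∑ x, ∫ ω, M.noiseAvg η Q₀ (fun i => ξ i ω) t x ^ 2 ∂μ :=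
        integral_finsetSum _ fun x _ => hi x
    _ ≤ ∑ x, C x * η t := Finset.sum_le_sum fun x _ => hC x t
    _ = _ := by rw [Finset.sum_mul]

variable [MeasurableSpace A] [MeasurableSingletonClass A]

/-- The mean-square error of Q-learning is of the order of the step size. After subtraction of the
noise process, the recursion is driven by a `γ`-contraction in the sup norm, up to an input of the
size of the noise process. -/
lemma IsGenerative.exists_integral_error_le (hξ : M.IsGenerative μ ξ) (hR : M.FourthMoment)
    (hη : StepSize η) (Q₀ : S × A → ℝ) (hQ : ∀ x, M.bellman M.Qstar x = M.Qstar x) :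
    ∃ C : ℝ, 0 ≤ C ∧
      ∀ t, ∫ ω, ‖M.iterate η Q₀ (fun i => ξ i ω) t - M.Qstar‖ ^ 2 ∂μ ≤ C * η t := by
  obtain ⟨C₁, hC₁0, hC₁⟩ := hξ.exists_integral_noiseAvg_le hR hη Q₀
  obtain ⟨c, hc⟩ : ∃ c, c = 1 - M.γ := ⟨_, rfl⟩
  have hγc : M.γ = 1 - c := by linarith
  have hγ := M.γ_pos.le
  have hc0 : 0 < c := by linarith [M.γ_lt_one]
  have hc1 : c ≤ 1 := by linarith
  set D : ℕ → Ω → S × A → ℝ := fun t ω =>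
    M.iterate η Q₀ (fun i => ξ i ω) t - M.Qstar - M.noiseAvg η Q₀ (fun i => ξ i ω) t with hD
  have hX2 := fun t => hξ.memLp_noiseAvg hR η Q₀ t
  have hQ2 := fun t => hξ.memLp_iterate hR η Q₀ t
  have hD2 : ∀ t, MemLp (D t) 2 μ := fun t => ((hQ2 t).sub (memLp_const _)).sub (hX2 t)
  obtain ⟨C₂, hC₂0, hC₂⟩ := hη.exists_le_mul_of_recursion hc0 hc1
    (K := M.γ ^ 2 / c * C₁) (by positivity) (u := fun t => ∫ ω, ‖D t ω‖ ^ 2 ∂μ) fun t => by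
      have hp := hη.pos (t + 1)
      have hθ0 : 0 ≤ c * η (t + 1) := by positivity
      have hθ1 : c * η (t + 1) ≤ 1 := by nlinarith [hη.le_one (t + 1)]
      have hpt : ∀ ω, ‖D (t + 1) ω‖ ^ 2 ≤ (1 - c * η (t + 1)) * ‖D t ω‖ ^ 2
          + c * η (t + 1) * (M.γ / c * ‖M.noiseAvg η Q₀ (fun i => ξ i ω) t‖) ^ 2 := by
        intro ω
        refine sq_le_of_le_convexComb hθ0 hθ1 (norm_nonneg _) ?_
        have e : (1 - c * η (t + 1)) * ‖D t ω‖
            + c * η (t + 1) * (M.γ / c * ‖M.noiseAvg η Q₀ (fun i => ξ i ω) t‖)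
            = (1 - η (t + 1)) * ‖D t ω‖ + η (t + 1) * (M.γ * (‖D t ω‖
              + ‖M.noiseAvg η Q₀ (fun i => ξ i ω) t‖)) := by
          rw [hγc]; field_simp; ring
        have hη1 : 0 ≤ 1 - η (t + 1) := sub_nonneg.2 (hη.le_one _)
        rw [e, pi_norm_le_iff_of_nonneg (by positivity)]
        intro x
        have e2 : D (t + 1) ω x = (1 - η (t + 1)) * D t ω x
            + η (t + 1) * (M.bellman (M.iterate η Q₀ (fun i => ξ i ω) t) x
              - M.bellman M.Qstar x) := by
          simp only [hD, Pi.sub_apply, iterate_succ, noiseAvg_succ, empBellman_eq, hQ]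
          ring
        rw [e2, Real.norm_eq_abs]
        refine (abs_add_le _ _).trans (add_le_add ?_ ?_)
        · rw [abs_mul, abs_of_nonneg hη1]
          exact mul_le_mul_of_nonneg_left (norm_le_pi_norm (D t ω) x) hη1
        · rw [abs_mul, abs_of_pos hp]
          refine mul_le_mul_of_nonneg_left ((M.abs_bellman_sub_le _ _ x).trans ?_) hp.le
          refine mul_le_mul_of_nonneg_left ?_ hγ
          have e3 : M.iterate η Q₀ (fun i => ξ i ω) t - M.Qstar
              = D t ω + M.noiseAvg η Q₀ (fun i => ξ i ω) t := by simp [hD]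
          rw [e3]
          exact norm_add_le _ _
      have i1 := ((hD2 t).norm.integrable_sq).const_mul (1 - c * η (t + 1))
      have i2 : Integrable (fun ω => c * η (t + 1)
          * (M.γ / c * ‖M.noiseAvg η Q₀ (fun i => ξ i ω) t‖) ^ 2) μ :=
        (((hX2 t).norm.const_mul _).integrable_sq).const_mul _
      calc _ ≤ ∫ ω, ((1 - c * η (t + 1)) * ‖D t ω‖ ^ 2 + c * η (t + 1)
            * (M.γ / c * ‖M.noiseAvg η Q₀ (fun i => ξ i ω) t‖) ^ 2) ∂μ :=
            integral_mono (hD2 (t + 1)).norm.integrable_sq (i1.add i2) hpt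
        _ = (1 - c * η (t + 1)) * ∫ ω, ‖D t ω‖ ^ 2 ∂μ + M.γ ^ 2 / c * η (t + 1)
            * ∫ ω, ‖M.noiseAvg η Q₀ (fun i => ξ i ω) t‖ ^ 2 ∂μ := by
            rw [integral_add i1 i2, integral_const_mul, integral_const_mul]
            simp_rw [mul_pow]
            rw [integral_const_mul]
            field_simp
        _ ≤ (1 - c * η (t + 1)) * ∫ ω, ‖D t ω‖ ^ 2 ∂μ + M.γ ^ 2 / c * η (t + 1)
            * (C₁ * η t) := by gcongr; exact hC₁ t
        _ = _ := by ring
  refine ⟨2 * C₂ + 2 * C₁, by positivity, fun t => ?_⟩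
  have i1 := (hD2 t).norm.integrable_sq.const_mul 2
  have i2 := (hX2 t).norm.integrable_sq.const_mul 2
  calc _ ≤ ∫ ω, (2 * ‖D t ω‖ ^ 2 + 2 * ‖M.noiseAvg η Q₀ (fun i => ξ i ω) t‖ ^ 2) ∂μ := by
        refine integral_mono (((hQ2 t).sub (memLp_const _)).norm.integrable_sq) (i1.add i2)
          fun ω => ?_
        have h := norm_add_le (D t ω) (M.noiseAvg η Q₀ (fun i => ξ i ω) t)
        rw [show D t ω + M.noiseAvg η Q₀ (fun i => ξ i ω) t
          = M.iterate η Q₀ (fun i => ξ i ω) t - M.Qstar by simp [hD]] at h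
        have h2 := pow_le_pow_left₀ (norm_nonneg _) h 2
        dsimp only
        nlinarith [sq_nonneg (‖D t ω‖ - ‖M.noiseAvg η Q₀ (fun i => ξ i ω) t‖)]
    _ = 2 * ∫ ω, ‖D t ω‖ ^ 2 ∂μ + 2 * ∫ ω, ‖M.noiseAvg η Q₀ (fun i => ξ i ω) t‖ ^ 2 ∂μ := by
        rw [integral_add i1 i2, integral_const_mul, integral_const_mul]
    _ ≤ _ := by
        have h1 := hC₁ t
        have h2 := hC₂ t
        linarith

end Rate
end MDP

/-! ### The multivariate central limit theorem -/

section CLT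

variable {Ω ι : Type*} [MeasurableSpace Ω] [Fintype ι] [DecidableEq ι] {P : Measure Ω}
  [IsProbabilityMeasure P]

/-- The central limit theorem for centered square-integrable vectors, by the Cramér–Wold device. -/
theorem tendstoInDistribution_inv_sqrt_smul_sum {X : ℕ → Ω → EuclideanSpace ℝ ι}
    (hX : MemLp (X 0) 2 P) (h0 : ∀ i, ∫ ω, X 0 ω i ∂P = 0) (hindep : iIndepFun X P)
    (hident : ∀ n, IdentDistrib (X n) (X 0) P P) :
    TendstoInDistribution (fun (n : ℕ) ω => (√(n : ℝ))⁻¹ • ∑ k ∈ Finset.range n, X k ω) atTop id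
      (fun _ => P) (multivariateGaussian 0 (covMatrix (fun ω => (X 0 ω).ofLp) P)) where
  forall_aemeasurable n := by
    have h := Finset.aemeasurable_fun_sum (Finset.range n) fun k _ => (hident k).aemeasurable_fst
    exact h.const_smul (√(n : ℝ))⁻¹
  tendsto := by
    have hXi : ∀ i, MemLp (fun ω => X 0 ω i) 2 P := fun i => hX.eval_piLp i
    refine ProbabilityMeasure.tendsto_iff_tendsto_charFun.2 fun u => ?_
    have hm : Measurable fun x : EuclideanSpace ℝ ι => inner ℝ x u := by fun_prop
    have hint : ∀ ω, inner ℝ (X 0 ω) u = u.ofLp ⬝ᵥ (X 0 ω).ofLp := fun ω => by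
      rw [EuclideanSpace.inner_eq_star_dotProduct, star_trivial]
    have h1 := tendstoInDistribution_inv_sqrt_mul_sum_sub (P := P)
      (X := fun k ω => inner ℝ (X k ω) u) (Y := id)
      (P' := gaussianReal 0 Var[fun ω => inner ℝ (X 0 ω) u; P].toNNReal) ⟨by fun_prop, by simp⟩
      (hX.inner_const u) (hindep.comp (fun _ x => inner ℝ x u) fun _ => hm)
      (fun k => (hident k).comp hm)
    have hmean : ∫ ω, inner ℝ (X 0 ω) u ∂P = 0 := by
      simp_rw [hint, dotProduct]
      rw [integral_finsetSum _ fun i _ => ((hXi i).integrable one_le_two).const_mul _]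
      simp [integral_const_mul, h0]
    have h2 := ProbabilityMeasure.tendsto_iff_tendsto_charFun.1 h1.tendsto 1
    simp only [ProbabilityMeasure.coe_mk, Measure.map_id, hmean, mul_zero, sub_zero] at h2 ⊢
    have hlim : charFun (gaussianReal 0 Var[fun ω => inner ℝ (X 0 ω) u; P].toNNReal) 1
        = charFun (multivariateGaussian 0 (covMatrix (fun ω => (X 0 ω).ofLp) P)) u := by
      rw [charFun_multivariateGaussian (posSemidef_covMatrix hXi), charFun_gaussianReal]
      have hv : Var[fun ω => inner ℝ (X 0 ω) u; P]
          = u.ofLp ⬝ᵥ covMatrix (fun ω => (X 0 ω).ofLp) P *ᵥ u.ofLp := by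
        rw [dotProduct_covMatrix_mulVec hXi]
        simp_rw [hint]
      rw [← hv]
      simp [Real.coe_toNNReal _ (variance_nonneg _ _)]
    rw [← hlim]
    refine h2.congr fun n => ?_
    have ha : AEMeasurable (fun ω => (√(n : ℝ))⁻¹ • ∑ k ∈ Finset.range n, X k ω) P := by
      have h := Finset.aemeasurable_fun_sum (Finset.range n) fun k _ => (hident k).aemeasurable_fst
      exact h.const_smul (√(n : ℝ))⁻¹
    rw [charFun_apply, charFun_apply, integral_map ha (by fun_prop), integral_map]
    · simp [inner_smul_left, sum_inner, Finset.mul_sum]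
    · exact (Finset.aemeasurable_fun_sum _ fun k _ =>
        hm.comp_aemeasurable (hident k).aemeasurable_fst).const_mul _
    · fun_prop

end CLT

/-! ### Convergence to zero in mean -/

section L1

variable {Ω : Type*} [MeasurableSpace Ω] {μ : Measure Ω}

/-- Convergence to zero in `L¹`, including integrability of each term. -/
structure TendstoL1Zero (μ : Measure Ω) (f : ℕ → Ω → ℝ) : Prop where
  integrable : ∀ n, Integrable (f n) μ
  tendsto : Tendsto (fun n => ∫ ω, |f n ω| ∂μ) atTop (𝓝 0)

namespace TendstoL1Zero

lemma of_le {f : ℕ → Ω → ℝ} {b : ℕ → ℝ} (hf : ∀ n, Integrable (f n) μ)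
    (h : ∀ n, ∫ ω, |f n ω| ∂μ ≤ b n) (hb : Tendsto b atTop (𝓝 0)) : TendstoL1Zero μ f :=
  ⟨hf, squeeze_zero (fun _ => integral_nonneg fun _ => abs_nonneg _) h hb⟩

lemma mono {f g : ℕ → Ω → ℝ} (hg : TendstoL1Zero μ g)
    (hf : ∀ n, AEStronglyMeasurable (f n) μ) (h : ∀ n ω, |f n ω| ≤ g n ω) :
    TendstoL1Zero μ f := by
  have hle : ∀ n ω, |f n ω| ≤ |g n ω| := fun n ω => (h n ω).trans (le_abs_self _)
  have hfi : ∀ n, Integrable (f n) μ := fun n => (hg.integrable n).mono (hf n) (ae_of_all _ (hle n))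
  exact of_le hfi (fun n => integral_mono (hfi n).abs (hg.integrable n).abs (hle n)) hg.tendsto

lemma add {f g : ℕ → Ω → ℝ} (hf : TendstoL1Zero μ f) (hg : TendstoL1Zero μ g) :
    TendstoL1Zero μ fun n ω => f n ω + g n ω := by
  refine of_le (fun n => (hf.integrable n).add (hg.integrable n)) (fun n => ?_)
    (by simpa using hf.tendsto.add hg.tendsto)
  rw [← integral_add (hf.integrable n).abs (hg.integrable n).abs]
  exact integral_mono ((hf.integrable n).add (hg.integrable n)).abs
    ((hf.integrable n).abs.add (hg.integrable n).abs) fun ω => abs_add_le _ _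

lemma const_mul {f : ℕ → Ω → ℝ} (hf : TendstoL1Zero μ f) (c : ℝ) :
    TendstoL1Zero μ fun n ω => c * f n ω := by
  refine of_le (fun n => (hf.integrable n).const_mul c) (fun n => le_of_eq ?_)
    (by simpa using hf.tendsto.const_mul |c|)
  simp_rw [abs_mul]
  rw [integral_const_mul]

lemma sum {ι : Type*} (s : Finset ι) {f : ι → ℕ → Ω → ℝ} (hf : ∀ i, TendstoL1Zero μ (f i)) :
    TendstoL1Zero μ fun n ω => ∑ i ∈ s, f i n ω := by
  classical
  induction s using Finset.induction_on with
  | empty => exact ⟨fun n => by simp, by simp⟩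
  | insert i s hi ih => simpa [Finset.sum_insert hi] using (hf i).add ih

lemma of_sq [IsProbabilityMeasure μ] {f : ℕ → Ω → ℝ} {b : ℕ → ℝ} (hf : ∀ n, MemLp (f n) 2 μ)
    (h : ∀ n, ∫ ω, f n ω ^ 2 ∂μ ≤ b n) (hb : Tendsto b atTop (𝓝 0)) : TendstoL1Zero μ f := by
  refine of_le (b := fun n => √(b n)) (fun n => (hf n).integrable one_le_two) (fun n => ?_)
    (by simpa [Function.comp_def] using (Real.continuous_sqrt.tendsto 0).comp hb)
  refine Real.le_sqrt_of_sq_le (le_trans ?_ (h n))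
  have hv := variance_nonneg |f n| μ
  rw [variance_eq_sub (hf n).abs] at hv
  simp only [Pi.pow_apply, Pi.abs_apply, sq_abs] at hv
  linarith

/-- Coordinatewise convergence in mean implies convergence in probability of vectors. -/
lemma tendstoInMeasure {ι : Type*} [Fintype ι] {f : ℕ → ι → Ω → ℝ}
    (hf : ∀ i, TendstoL1Zero μ fun n => f n i) :
    TendstoInMeasure μ (fun n ω => (WithLp.toLp 2 fun i => f n i ω : EuclideanSpace ℝ ι)) atTop
      0 := by
  have hle : ∀ v : ι → ℝ, ‖(WithLp.toLp 2 v : EuclideanSpace ℝ ι)‖ ≤ ∑ i, |v i| := by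
    intro v
    rw [EuclideanSpace.norm_eq]
    refine Real.sqrt_le_iff.2 ⟨Finset.sum_nonneg fun i _ => abs_nonneg _, ?_⟩
    exact Finset.sum_sq_le_sq_sum_of_nonneg fun i _ => abs_nonneg _
  have hi : ∀ n, Integrable (fun ω => (WithLp.toLp 2 fun i => f n i ω : EuclideanSpace ℝ ι)) μ :=
    fun n => Integrable.of_eval_piLp fun i => (hf i).integrable n
  refine tendstoInMeasure_of_tendsto_eLpNorm one_ne_zero
    (fun n => (hi n).aestronglyMeasurable) aestronglyMeasurable_zero ?_
  have hlim : Tendsto (fun n => ENNReal.ofReal (∑ i, ∫ ω, |f n i ω| ∂μ)) atTop (𝓝 0) := by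
    rw [← ENNReal.ofReal_zero, ← Finset.sum_const_zero (s := (Finset.univ : Finset ι))]
    exact ENNReal.tendsto_ofReal (tendsto_finsetSum _ fun i _ => (hf i).tendsto)
  refine tendsto_of_tendsto_of_tendsto_of_le_of_le tendsto_const_nhds hlim
    (fun _ => zero_le) fun n => ?_
  rw [sub_zero, eLpNorm_one_eq_lintegral_enorm, ← ofReal_integral_norm_eq_lintegral_enorm (hi n)]
  refine ENNReal.ofReal_le_ofReal ?_
  rw [← integral_finsetSum _ fun i _ => ((hf i).integrable n).abs]
  exact integral_mono (hi n).norm (integrable_finsetSum _ fun i _ => ((hf i).integrable n).abs)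
    fun ω => hle _

end TendstoL1Zero
end L1

lemma StepSize.tendsto_inv_sqrt_mul_sum {η : ℕ → ℝ} (hη : StepSize η) (C : ℝ) :
    Tendsto (fun T : ℕ => C * (1 / √(T : ℝ) * ∑ t ∈ Finset.range (T + 1), η t)) atTop (𝓝 0) := by
  simpa using hη.sum_sqrt.const_mul C

namespace MDP

/-! ### Negligible terms of the averaged recursion -/

section Remainder

variable {S A : Type*} [Fintype S] [Fintype A] [DecidableEq S] [MeasurableSpace S]
  [MeasurableSingletonClass S] [MeasurableSpace A] [MeasurableSingletonClass A] {M : MDP S A}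
  {Ω : Type*} [MeasurableSpace Ω] {μ : Measure Ω} [IsProbabilityMeasure μ]
  {ξ : ℕ → Ω → Sample S A} {η : ℕ → ℝ} {Q₀ : S × A → ℝ} {C : ℝ}

variable (M) in
/-- The error `Q_t - Q*` of the iterates. -/
noncomputable def error (η : ℕ → ℝ) (Q₀ : S × A → ℝ) (ξ : ℕ → Sample S A) (t : ℕ) : S × A → ℝ :=
  M.iterate η Q₀ ξ t - M.Qstar

lemma IsGenerative.memLp_error (hξ : M.IsGenerative μ ξ) (hR : M.FourthMoment) (t : ℕ) :
    MemLp (fun ω => M.error η Q₀ (fun i => ξ i ω) t) 2 μ :=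
  (hξ.memLp_iterate hR η Q₀ t).sub (memLp_const _)

/-- The first absolute moments of the error are of the order of the square root of the step
size. -/
lemma IsGenerative.integral_abs_error_le (hξ : M.IsGenerative μ ξ) (hR : M.FourthMoment)
    (hη : StepSize η)
    (hC : ∀ t, ∫ ω, ‖M.error η Q₀ (fun i => ξ i ω) t‖ ^ 2 ∂μ ≤ C * η t) (t : ℕ) (x : S × A) :
    ∫ ω, |M.error η Q₀ (fun i => ξ i ω) t x| ∂μ ≤ (C + 1) * √(η t) := by
  have hs := Real.sqrt_pos.2 (hη.pos t)
  have h2 := hξ.memLp_error (η := η) (Q₀ := Q₀) hR t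
  have i1 := h2.norm.integrable_sq.div_const √(η t)
  calc _ ≤ ∫ ω, (‖M.error η Q₀ (fun i => ξ i ω) t‖ ^ 2 / √(η t) + √(η t)) ∂μ := by
        refine integral_mono ((h2.eval x).integrable one_le_two).abs
          (i1.add (integrable_const _)) fun ω => ?_
        have h1 : |M.error η Q₀ (fun i => ξ i ω) t x| ≤ ‖M.error η Q₀ (fun i => ξ i ω) t‖ :=
          norm_le_pi_norm (M.error η Q₀ (fun i => ξ i ω) t) x
        have h0 := norm_nonneg (M.error η Q₀ (fun i => ξ i ω) t)
        -- The arithmetic-geometric mean inequality with weight `√η_t`.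
        refine h1.trans ?_
        rw [div_add' _ _ _ hs.ne', le_div_iff₀ hs]
        nlinarith [sq_nonneg (‖M.error η Q₀ (fun i => ξ i ω) t‖ - √(η t))]
    _ = (∫ ω, ‖M.error η Q₀ (fun i => ξ i ω) t‖ ^ 2 ∂μ) / √(η t) + √(η t) := by
        rw [integral_add i1 (integrable_const _), integral_div]; simp
    _ ≤ C * η t / √(η t) + √(η t) := by gcongr; exact hC t
    _ = (C + 1) * √(η t) := by rw [mul_div_assoc, Real.div_sqrt]; ring

lemma IsGenerative.tendstoL1Zero_sum_sq (hξ : M.IsGenerative μ ξ) (hR : M.FourthMoment)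
    (hη : StepSize η)
    (hC : ∀ t, ∫ ω, ‖M.error η Q₀ (fun i => ξ i ω) t‖ ^ 2 ∂μ ≤ C * η t) :
    TendstoL1Zero μ fun T ω => 1 / √(T : ℝ) * ∑ t ∈ Finset.range (T + 1),
      ‖M.error η Q₀ (fun i => ξ i ω) t‖ ^ 2 := by
  have hi := fun t => (hξ.memLp_error (η := η) (Q₀ := Q₀) hR t).norm.integrable_sq
  refine .of_le (fun T => (integrable_finsetSum _ fun t _ => hi t).const_mul _) (fun T => ?_)
    (hη.tendsto_inv_sqrt_mul_sum C)
  have h0 : ∀ ω, 0 ≤ 1 / √(T : ℝ) * ∑ t ∈ Finset.range (T + 1),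
      ‖M.error η Q₀ (fun i => ξ i ω) t‖ ^ 2 := fun ω =>
    mul_nonneg (by positivity) (Finset.sum_nonneg fun t _ => sq_nonneg _)
  simp_rw [abs_of_nonneg (h0 _)]
  rw [integral_const_mul, integral_finsetSum _ fun t _ => hi t, mul_left_comm C,
    Finset.mul_sum _ _ C]
  exact mul_le_mul_of_nonneg_left (Finset.sum_le_sum fun t _ => hC t) (by positivity)

/-- The transition noise acting on `V_t - V*` is a martingale difference whose variance is of the
order of the step size, hence negligible at the scale `√T`. -/
lemma IsGenerative.tendstoL1Zero_sum_sampleNoise (hξ : M.IsGenerative μ ξ) (hR : M.FourthMoment)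
    (hη : StepSize η) (hC0 : 0 ≤ C)
    (hC : ∀ t, ∫ ω, ‖M.error η Q₀ (fun i => ξ i ω) t‖ ^ 2 ∂μ ≤ C * η t) (x : S × A) :
    TendstoL1Zero μ fun T ω => 1 / √(T : ℝ) * ∑ t ∈ Finset.range T,
      M.sampleNoise 0 (fun s => greedyValue (M.iterate η Q₀ (fun i => ξ i ω) t) s
        - greedyValue M.Qstar s) (ξ (t + 1) ω) x := by
  set v : ℕ → Ω → S → ℝ := fun t ω s => greedyValue (M.iterate η Q₀ (fun i => ξ i ω) t) s
    - greedyValue M.Qstar s with hv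
  have hvm : ∀ t, Measurable[past ξ t] (v t) := fun t =>
    (measurable_greedyValue_pi.comp (measurable_iterate (M := M) η Q₀ ξ t)).sub measurable_const
  have hv2 : ∀ t s, MemLp (fun ω => v t ω s) 2 μ := fun t s =>
    ((memLp_greedyValue (hξ.memLp_iterate hR η Q₀ t)).eval s).sub (memLp_const _)
  set N : ℕ → Ω → ℝ := fun t ω => M.sampleNoise 0 (v t ω) (ξ (t + 1) ω) x with hN
  have hN2 : ∀ t, MemLp (N t) 2 μ := fun t =>
    hξ.memLp_sampleNoise hR 0 (hv2 t) x ((hvm t).mono (hξ.past_le t) le_rfl)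
  have hNm : ∀ t, Measurable[past ξ (t + 1)] (N t) := fun t =>
    (M.measurable_sampleNoise 0 x).comp
      ((measurable_past ξ t).prodMk ((hvm t).mono (past_mono ξ (Nat.le_succ t)) le_rfl))
  have hNsq : ∀ t, ∫ ω, N t ω ^ 2 ∂μ ≤ 4 * C * η t := by
    intro t
    have i1 := (hξ.memLp_error (η := η) (Q₀ := Q₀) hR t).norm.integrable_sq
    calc _ ≤ ∫ ω, 4 * ‖M.error η Q₀ (fun i => ξ i ω) t‖ ^ 2 ∂μ := by
          refine integral_mono (hN2 t).integrable_sq (i1.const_mul 4) fun ω => ?_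
          have h := M.abs_sampleNoise_le 0 (v := v t ω)
            (fun s => abs_greedyValue_sub_le (M.iterate η Q₀ (fun i => ξ i ω) t) M.Qstar s)
            (ξ (t + 1) ω) x
          rw [abs_zero, zero_mul, zero_add] at h
          have h2 := pow_le_pow_left₀ (abs_nonneg _) h 2
          rw [sq_abs, mul_pow] at h2
          refine h2.trans (le_of_eq ?_)
          norm_num [error]
      _ = 4 * ∫ ω, ‖M.error η Q₀ (fun i => ξ i ω) t‖ ^ 2 ∂μ := integral_const_mul _ _
      _ ≤ _ := by linarith [hC t]
  have hsumm : ∀ T, Measurable[past ξ T] fun ω => ∑ t ∈ Finset.range T, N t ω := fun T =>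
    Finset.measurable_fun_sum _ fun t ht =>
      (hNm t).mono (past_mono ξ (Finset.mem_range.1 ht)) le_rfl
  have hsum2 : ∀ T, MemLp (fun ω => ∑ t ∈ Finset.range T, N t ω) 2 μ := fun T =>
    memLp_finsetSum _ fun t _ => hN2 t
  have hpyth : ∀ T : ℕ, ∫ ω, (∑ t ∈ Finset.range T, N t ω) ^ 2 ∂μ
      = ∑ t ∈ Finset.range T, ∫ ω, N t ω ^ 2 ∂μ := by
    intro T
    induction T with
    | zero => simp
    | succ T ih =>
      have h := hξ.integral_sq_add_sampleNoise hR 0 1 1 (hsumm T) (hsum2 T) (hvm T) (hv2 T) x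
      simp only [one_mul, one_pow] at h
      simp_rw [Finset.sum_range_succ]
      rw [← ih]
      exact h
  refine .of_sq (fun T => (hsum2 T).const_mul _) (fun T => ?_)
    (hη.tendsto_inv_sqrt_mul_sum (4 * C))
  simp_rw [mul_pow]
  rw [integral_const_mul, hpyth]
  -- At `T = 0` both sides are `1 / 0 = 0`.
  have h1 : (1 / √(T : ℝ)) ^ 2 ≤ 1 / √(T : ℝ) := by
    rcases Nat.eq_zero_or_pos T with rfl | hT
    · simp
    · have : 1 ≤ √(T : ℝ) := Real.one_le_sqrt.2 (by exact_mod_cast hT)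
      have h2 : 1 / √(T : ℝ) ≤ 1 := (div_le_one (by linarith)).2 this
      have h3 : 0 ≤ 1 / √(T : ℝ) := by positivity
      nlinarith
  calc _ ≤ 1 / √(T : ℝ) * ∑ t ∈ Finset.range (T + 1), 4 * C * η t := by
        refine mul_le_mul h1 ?_ (Finset.sum_nonneg fun t _ => integral_nonneg fun _ => sq_nonneg _)
          (by positivity)
        refine (Finset.sum_le_sum fun t _ => hNsq t).trans ?_
        refine Finset.sum_le_sum_of_subset_of_nonneg (Finset.range_mono (Nat.le_succ T))
          fun t _ _ => ?_
        have := hη.pos t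
        positivity
    _ = _ := by rw [← Finset.mul_sum]; ring

/-- The telescoping term of the averaged recursion is negligible, by summation by parts. -/
lemma IsGenerative.tendstoL1Zero_telescope (hξ : M.IsGenerative μ ξ) (hR : M.FourthMoment)
    (hη : StepSize η) (hC : ∀ t, ∫ ω, ‖M.error η Q₀ (fun i => ξ i ω) t‖ ^ 2 ∂μ ≤ C * η t)
    (x : S × A) :
    TendstoL1Zero μ fun T ω => 1 / √(T : ℝ) * ∑ t ∈ Finset.range T, (η (t + 1))⁻¹ *
      (M.error η Q₀ (fun i => ξ i ω) t x - M.error η Q₀ (fun i => ξ i ω) (t + 1) x) := by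
  have hi : ∀ t, Integrable (fun ω => M.error η Q₀ (fun i => ξ i ω) t x) μ := fun t =>
    ((hξ.memLp_error hR t).eval x).integrable one_le_two
  have hK := fun t => hξ.integral_abs_error_le (Q₀ := Q₀) hR hη hC t x
  have hinv : Tendsto (fun T : ℕ => 1 / √(T : ℝ)) atTop (𝓝 0) := by
    simpa [one_div, Function.comp_def] using (tendsto_inv_atTop_zero.comp
      (Real.tendsto_sqrt_atTop.comp tendsto_natCast_atTop_atTop))
  have hlim : Tendsto (fun T : ℕ => 1 / √(T : ℝ) * ((η 0)⁻¹ * ((C + 1) * √(η 0)))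
      + (C + 1) * (1 / √(T : ℝ) * ((η T)⁻¹ * √(η T)))
      + (C + 1) * (1 / √(T : ℝ) *
        ∑ t ∈ Finset.range T, ((η (t + 1))⁻¹ - (η t)⁻¹) * √(η t))) atTop (𝓝 0) := by
    have h1 := hinv.mul_const ((η 0)⁻¹ * ((C + 1) * √(η 0)))
    have h2 := hη.tendsto_inv_sqrt_mul_inv_mul_sqrt.const_mul (C + 1)
    have h3 := hη.tendsto_sum_inv_sub_inv.const_mul (C + 1)
    simpa using (h1.add h2).add h3
  refine .of_le (fun T => (integrable_finsetSum _ fun t _ =>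
    ((hi t).sub (hi (t + 1))).const_mul _).const_mul _) (fun T => ?_) hlim
  have hp := fun t => inv_nonneg.2 (hη.pos t).le
  have hw := hη.inv_succ_sub_inv_nonneg
  have j0 : Integrable (fun ω => (η 0)⁻¹ * |M.error η Q₀ (fun i => ξ i ω) 0 x|) μ :=
    (hi 0).abs.const_mul _
  have jT : Integrable (fun ω => (η T)⁻¹ * |M.error η Q₀ (fun i => ξ i ω) T x|) μ :=
    (hi T).abs.const_mul _
  have jt : ∀ t, Integrable (fun ω =>
      ((η (t + 1))⁻¹ - (η t)⁻¹) * |M.error η Q₀ (fun i => ξ i ω) t x|) μ :=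
    fun t => (hi t).abs.const_mul _
  have jS : Integrable (fun ω => ∑ t ∈ Finset.range T,
      ((η (t + 1))⁻¹ - (η t)⁻¹) * |M.error η Q₀ (fun i => ξ i ω) t x|) μ :=
    integrable_finsetSum _ fun t _ => jt t
  have j0T : Integrable (fun ω => (η 0)⁻¹ * |M.error η Q₀ (fun i => ξ i ω) 0 x|
      + (η T)⁻¹ * |M.error η Q₀ (fun i => ξ i ω) T x|) μ := j0.add jT
  calc _ ≤ ∫ ω, 1 / √(T : ℝ) * ((η 0)⁻¹ * |M.error η Q₀ (fun i => ξ i ω) 0 x|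
        + (η T)⁻¹ * |M.error η Q₀ (fun i => ξ i ω) T x| + ∑ t ∈ Finset.range T,
          ((η (t + 1))⁻¹ - (η t)⁻¹) * |M.error η Q₀ (fun i => ξ i ω) t x|) ∂μ := by
        refine integral_mono ((integrable_finsetSum _ fun t _ =>
          ((hi t).sub (hi (t + 1))).const_mul _).const_mul _).abs
          ((j0T.add jS).const_mul _) fun ω => ?_
        dsimp only
        rw [StepSize.sum_inv_mul_sub (fun t => M.error η Q₀ (fun i => ξ i ω) t x), abs_mul,
          abs_of_nonneg (by positivity : 0 ≤ 1 / √(T : ℝ))]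
        refine mul_le_mul_of_nonneg_left ?_ (by positivity)
        refine (abs_add_le _ _).trans (add_le_add ((abs_sub _ _).trans (le_of_eq ?_)) ?_)
        · rw [abs_mul, abs_mul, abs_of_nonneg (hp 0), abs_of_nonneg (hp T)]
        · refine (Finset.abs_sum_le_sum_abs _ _).trans (le_of_eq ?_)
          exact Finset.sum_congr rfl fun t _ => by rw [abs_mul, abs_of_nonneg (hw t)]
    _ = 1 / √(T : ℝ) * ((η 0)⁻¹ * ∫ ω, |M.error η Q₀ (fun i => ξ i ω) 0 x| ∂μ
        + (η T)⁻¹ * ∫ ω, |M.error η Q₀ (fun i => ξ i ω) T x| ∂μ + ∑ t ∈ Finset.range T,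
          ((η (t + 1))⁻¹ - (η t)⁻¹) * ∫ ω, |M.error η Q₀ (fun i => ξ i ω) t x| ∂μ) := by
        rw [integral_const_mul, integral_add j0T jS, integral_add j0 jT, integral_const_mul,
          integral_const_mul, integral_finsetSum _ fun t _ => jt t]
        simp_rw [integral_const_mul]
    _ ≤ 1 / √(T : ℝ) * ((η 0)⁻¹ * ((C + 1) * √(η 0)) + (η T)⁻¹ * ((C + 1) * √(η T))
        + ∑ t ∈ Finset.range T, ((η (t + 1))⁻¹ - (η t)⁻¹) * ((C + 1) * √(η t))) := by
        gcongr with t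
        · exact hp 0
        · exact hK 0
        · exact hp T
        · exact hK T
        · exact hw t
        · exact hK t
    _ = _ := by
        simp_rw [mul_left_comm _ (C + 1)]
        rw [← Finset.mul_sum]
        ring

/-- The boundary term from shifting the summation index of the averaged error is negligible. -/
lemma IsGenerative.tendstoL1Zero_sub (hξ : M.IsGenerative μ ξ) (hR : M.FourthMoment)
    (hη : StepSize η) (hC0 : 0 ≤ C)
    (hC : ∀ t, ∫ ω, ‖M.error η Q₀ (fun i => ξ i ω) t‖ ^ 2 ∂μ ≤ C * η t) (x : S × A) :
    TendstoL1Zero μ fun T ω => 1 / √(T : ℝ) *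
      (M.error η Q₀ (fun i => ξ i ω) T x - M.error η Q₀ (fun i => ξ i ω) 0 x) := by
  have hi : ∀ t, Integrable (fun ω => M.error η Q₀ (fun i => ξ i ω) t x) μ := fun t =>
    ((hξ.memLp_error hR t).eval x).integrable one_le_two
  have hK : ∀ t, ∫ ω, |M.error η Q₀ (fun i => ξ i ω) t x| ∂μ ≤ C + 1 := fun t =>
    (hξ.integral_abs_error_le (Q₀ := Q₀) hR hη hC t x).trans
      (mul_le_of_le_one_right (by linarith) (Real.sqrt_le_one.2 (hη.le_one t)))
  have hinv : Tendsto (fun T : ℕ => 1 / √(T : ℝ) * (2 * (C + 1))) atTop (𝓝 0) := by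
    simpa [one_div, Function.comp_def] using (tendsto_inv_atTop_zero.comp
      (Real.tendsto_sqrt_atTop.comp tendsto_natCast_atTop_atTop)).mul_const (2 * (C + 1))
  refine .of_le (fun T => ((hi T).sub (hi 0)).const_mul _) (fun T => ?_) hinv
  simp_rw [abs_mul]
  rw [integral_const_mul, abs_of_nonneg (by positivity : 0 ≤ 1 / √(T : ℝ))]
  refine mul_le_mul_of_nonneg_left ?_ (by positivity)
  calc _ ≤ ∫ ω, (|M.error η Q₀ (fun i => ξ i ω) T x| + |M.error η Q₀ (fun i => ξ i ω) 0 x|) ∂μ :=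
        integral_mono ((hi T).sub (hi 0)).abs ((hi T).abs.add (hi 0).abs) fun ω => abs_sub _ _
    _ ≤ _ := by
        rw [integral_add (hi T).abs (hi 0).abs]
        linarith [hK T, hK 0]

end Remainder

/-! ### The averaged recursion -/

section Average

variable {S A : Type*} [Fintype S] [Fintype A] [DecidableEq S] [DecidableEq A] [MeasurableSpace S]
  [MeasurableSingletonClass S] [MeasurableSpace A] [MeasurableSingletonClass A] {M : MDP S A}
  {η : ℕ → ℝ} {Q₀ : S × A → ℝ} {b : S → A}

/-- One step of Q-learning, solved for the error before the step. On the left stands the linear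
part of the Bellman operator at `Q*`, whose greedy policy is `b`; on the right stand the noise at
`Q*`, the excess noise, the linearization error and a telescoping term. -/
lemma error_sub_eq (hη : StepSize η) (hQ : ∀ x, M.bellman M.Qstar x = M.Qstar x)
    (hb : ∀ s, greedyValue M.Qstar s = M.Qstar (s, b s)) (ξ : ℕ → Sample S A) (t : ℕ)
    (x : S × A) :
    M.error η Q₀ ξ t x - M.γ * ∑ s', (M.P x s').toReal * M.error η Q₀ ξ t (s', b s')
      = M.bellmanNoise (ξ (t + 1)) x
        + M.sampleNoise 0 (fun s => greedyValue (M.iterate η Q₀ ξ t) s - greedyValue M.Qstar s)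
          (ξ (t + 1)) x
        + M.γ * ∑ s', (M.P x s').toReal *
          (greedyValue (M.iterate η Q₀ ξ t) s' - M.iterate η Q₀ ξ t (s', b s'))
        + (η (t + 1))⁻¹ * (M.error η Q₀ ξ t x - M.error η Q₀ ξ (t + 1) x) := by
  have h1 : (η (t + 1))⁻¹ * (M.error η Q₀ ξ t x - M.error η Q₀ ξ (t + 1) x)
      = M.iterate η Q₀ ξ t x - M.empBellman (ξ (t + 1)) (M.iterate η Q₀ ξ t) x := by
    have := (hη.pos (t + 1)).ne'
    simp only [error, Pi.sub_apply, iterate_succ]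
    field_simp
    ring
  have h2 := M.sampleNoise_add 1 0 (greedyValue M.Qstar)
    (fun s => greedyValue (M.iterate η Q₀ ξ t) s - greedyValue M.Qstar s) (ξ (t + 1)) x
  simp only [add_zero, add_sub_cancel] at h2
  have h3 := hQ x
  rw [h1, empBellman_eq, bellmanNoise_eq]
  rw [bellman] at h3 ⊢
  simp only [hb] at h2 h3 ⊢
  simp only [error, Pi.sub_apply, mul_sub, Finset.sum_sub_distrib] at h2 h3 ⊢
  linarith

lemma PdownMat_pure_mulVec (v : S → ℝ) (s : S) :
    (M.PdownMat (fun s => PMF.pure (b s)) *ᵥ v) s = ∑ s', (M.P (s, b s) s').toReal * v s' := by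
  rw [PdownMat, ← mulVec_mulVec, projMat_mulVec, policyValue_pure, Pmat_mulVec]

/-- The averaged error of the greedy actions is the resolvent applied to the accumulated noise,
excess noise, linearization error and telescoping terms. -/
lemma sum_error_eq (hη : StepSize η) (hQ : ∀ x, M.bellman M.Qstar x = M.Qstar x)
    (hb : ∀ s, greedyValue M.Qstar s = M.Qstar (s, b s)) (ξ : ℕ → Sample S A) (T : ℕ) :
    (fun s => ∑ t ∈ Finset.range T, M.error η Q₀ ξ t (s, b s))
      = (1 - M.γ • M.PdownMat fun s => PMF.pure (b s))⁻¹ *ᵥ fun s =>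
        ∑ t ∈ Finset.range T, M.bellmanNoise (ξ (t + 1)) (s, b s)
        + ∑ t ∈ Finset.range T, M.sampleNoise 0
          (fun s => greedyValue (M.iterate η Q₀ ξ t) s - greedyValue M.Qstar s)
          (ξ (t + 1)) (s, b s)
        + ∑ t ∈ Finset.range T, M.γ * ∑ s', (M.P (s, b s) s').toReal *
          (greedyValue (M.iterate η Q₀ ξ t) s' - M.iterate η Q₀ ξ t (s', b s'))
        + ∑ t ∈ Finset.range T, (η (t + 1))⁻¹ *
          (M.error η Q₀ ξ t (s, b s) - M.error η Q₀ ξ (t + 1) (s, b s)) := by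
  have hu := (Matrix.isUnit_iff_isUnit_det _).1
    (M.isUnit_one_sub_PdownMat fun s => PMF.pure (b s))
  have key : (1 - M.γ • M.PdownMat fun s => PMF.pure (b s)) *ᵥ
      (fun s => ∑ t ∈ Finset.range T, M.error η Q₀ ξ t (s, b s)) = fun s =>
        ∑ t ∈ Finset.range T, M.bellmanNoise (ξ (t + 1)) (s, b s)
        + ∑ t ∈ Finset.range T, M.sampleNoise 0
          (fun s => greedyValue (M.iterate η Q₀ ξ t) s - greedyValue M.Qstar s)
          (ξ (t + 1)) (s, b s)
        + ∑ t ∈ Finset.range T, M.γ * ∑ s', (M.P (s, b s) s').toReal *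
          (greedyValue (M.iterate η Q₀ ξ t) s' - M.iterate η Q₀ ξ t (s', b s'))
        + ∑ t ∈ Finset.range T, (η (t + 1))⁻¹ *
          (M.error η Q₀ ξ t (s, b s) - M.error η Q₀ ξ (t + 1) (s, b s)) := by
    ext s
    simp_rw [← Finset.sum_add_distrib, ← error_sub_eq hη hQ hb ξ]
    rw [sub_mulVec, smul_mulVec, one_mulVec, Pi.sub_apply, Pi.smul_apply, PdownMat_pure_mulVec,
      smul_eq_mul, Finset.sum_sub_distrib, ← Finset.mul_sum, Finset.sum_comm]
    simp_rw [Finset.mul_sum]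
  rw [← key, mulVec_mulVec, Matrix.nonsing_inv_mul _ hu, one_mulVec]

lemma sqrt_mul_one_div (T : ℕ) : √(T : ℝ) * (1 / (T : ℝ)) = 1 / √(T : ℝ) := by
  rw [mul_one_div, Real.sqrt_div_self']

/-- The identity also holds at `T = 0`, where both sides vanish by division by zero. -/
lemma sqrt_mul_avgQ_sub (ξ : ℕ → Sample S A) (T : ℕ) (x : S × A) :
    √(T : ℝ) * (M.avgQ η Q₀ ξ T x - M.Qstar x)
      = 1 / √(T : ℝ) * ∑ t ∈ Finset.range T, M.error η Q₀ ξ t x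
        + 1 / √(T : ℝ) * (M.error η Q₀ ξ T x - M.error η Q₀ ξ 0 x) := by
  rcases Nat.eq_zero_or_pos T with rfl | hT
  · simp
  have hT' : (T : ℝ) ≠ 0 := by exact_mod_cast hT.ne'
  have h1 : M.avgQ η Q₀ ξ T x - M.Qstar x
      = 1 / (T : ℝ) * ∑ t ∈ Finset.range T, M.error η Q₀ ξ (t + 1) x := by
    rw [avgQ, Finset.range_eq_Ico, Finset.sum_Ico_add' (fun t => M.error η Q₀ ξ t x),
      Finset.Ico_add_one_right_eq_Icc]
    simp only [error, Pi.sub_apply, Finset.sum_sub_distrib, Finset.sum_const, Nat.card_Icc,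
      nsmul_eq_mul, zero_add, Nat.add_sub_cancel]
    field_simp
  have h2 := Finset.sum_range_succ_sub_sum (M := ℝ) (fun t => M.error η Q₀ ξ t x) (n := T)
  have h3 := Finset.sum_range_succ' (fun t => M.error η Q₀ ξ t x) T
  rw [h1, ← mul_assoc, sqrt_mul_one_div, ← mul_add]
  congr 1
  linarith

/-- By Jensen's inequality, the squared error of the averaged iterates, at the scale `√T`, is
controlled by the accumulated squared errors. -/
lemma sqrt_mul_norm_avgQ_sub_sq_le (ξ : ℕ → Sample S A) (T : ℕ) :
    √(T : ℝ) * ‖M.avgQ η Q₀ ξ T - M.Qstar‖ ^ 2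
      ≤ 1 / √(T : ℝ) * ∑ t ∈ Finset.range (T + 1), ‖M.error η Q₀ ξ t‖ ^ 2 := by
  rcases Nat.eq_zero_or_pos T with rfl | hT
  · simp
  have hT' : (0 : ℝ) < T := by exact_mod_cast hT
  have h1 : M.avgQ η Q₀ ξ T - M.Qstar
      = (1 / (T : ℝ)) • ∑ t ∈ Finset.Icc 1 T, M.error η Q₀ ξ t := by
    ext x
    rw [Pi.sub_apply, Pi.smul_apply, Finset.sum_apply]
    simp only [avgQ, error, Pi.sub_apply, smul_eq_mul,
      Finset.sum_sub_distrib, Finset.sum_const, Nat.card_Icc, nsmul_eq_mul, Nat.add_sub_cancel]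
    field_simp
  have h2 : ‖M.avgQ η Q₀ ξ T - M.Qstar‖
      ≤ 1 / (T : ℝ) * ∑ t ∈ Finset.Icc 1 T, ‖M.error η Q₀ ξ t‖ := by
    rw [h1, norm_smul, Real.norm_of_nonneg (by positivity)]
    exact mul_le_mul_of_nonneg_left (norm_sum_le _ _) (by positivity)
  have h3 := sq_sum_le_card_mul_sum_sq (s := Finset.Icc 1 T)
    (f := fun t => ‖M.error η Q₀ ξ t‖)
  rw [Nat.card_Icc, Nat.add_sub_cancel] at h3
  have h4 : ∑ t ∈ Finset.Icc 1 T, ‖M.error η Q₀ ξ t‖ ^ 2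
      ≤ ∑ t ∈ Finset.range (T + 1), ‖M.error η Q₀ ξ t‖ ^ 2 :=
    Finset.sum_le_sum_of_subset_of_nonneg
      (fun t ht => Finset.mem_range_succ_iff.2 (Finset.mem_Icc.1 ht).2) fun t _ _ => sq_nonneg _
  calc √(T : ℝ) * ‖M.avgQ η Q₀ ξ T - M.Qstar‖ ^ 2
      ≤ √(T : ℝ) * (1 / (T : ℝ) * ∑ t ∈ Finset.Icc 1 T, ‖M.error η Q₀ ξ t‖) ^ 2 := by gcongr
    _ ≤ √(T : ℝ) * ((1 / (T : ℝ)) ^ 2 *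
        (T * ∑ t ∈ Finset.Icc 1 T, ‖M.error η Q₀ ξ t‖ ^ 2)) := by rw [mul_pow]; gcongr
    _ = 1 / √(T : ℝ) * ∑ t ∈ Finset.Icc 1 T, ‖M.error η Q₀ ξ t‖ ^ 2 := by
        rw [← sqrt_mul_one_div]; field_simp
    _ ≤ _ := mul_le_mul_of_nonneg_left h4 (by positivity)

variable {Ω : Type*} [MeasurableSpace Ω] {μ : Measure Ω} [IsProbabilityMeasure μ]
  {ξ : ℕ → Ω → Sample S A}

/-- Asymptotic linearity of the averaged value estimate: up to a remainder vanishing in mean, its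
rescaled error is the resolvent applied to the normalized sum of the Bellman noises. -/
theorem IsGenerative.exists_remainder (hξ : M.IsGenerative μ ξ) (hR : M.FourthMoment)
    (hη : StepSize η) (hQ : ∀ x, M.bellman M.Qstar x = M.Qstar x)
    (hgap : ∀ s a, a ≠ b s → M.Qstar (s, a) < M.Qstar (s, b s))
    (hb : ∀ s, greedyValue M.Qstar s = M.Qstar (s, b s))
    (hV : ∀ s, M.Vstar s = M.Qstar (s, b s)) :
    ∃ R : ℕ → S → Ω → ℝ, (∀ s, TendstoL1Zero μ fun T => R T s) ∧
      ∀ (T : ℕ) (s : S) (ω : Ω), √(T : ℝ) * (M.avgV η Q₀ (fun i => ξ i ω) T s - M.Vstar s)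
        = (√(T : ℝ))⁻¹ * ∑ t ∈ Finset.range T, ((1 - M.γ • M.PdownMat fun s => PMF.pure (b s))⁻¹ *ᵥ
          (projMat (fun s => PMF.pure (b s)) *ᵥ M.bellmanNoise (ξ (t + 1) ω))) s + R T s ω := by
  obtain ⟨C, hC0, hC⟩ := hξ.exists_integral_error_le hR hη Q₀ hQ
  obtain ⟨L, hL0, hL⟩ := exists_greedyValue_sub_le hgap
  set H := (1 - M.γ • M.PdownMat fun s => PMF.pure (b s))⁻¹ with hH
  have hmeas : ∀ t, Measurable fun ω => M.iterate η Q₀ (fun i => ξ i ω) t := fun t =>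
    (measurable_iterate (M := M) η Q₀ ξ t).mono (hξ.past_le t) le_rfl
  have hρ0 : ∀ (Q : S × A → ℝ) s, 0 ≤ greedyValue Q s - Q (s, b s) := fun Q s =>
    sub_nonneg.2 (le_greedyValue Q s (b s))
  have hsq := hξ.tendstoL1Zero_sum_sq (Q₀ := Q₀) hR hη hC
  have hlin : ∀ s, TendstoL1Zero μ fun T ω => 1 / √(T : ℝ) * ∑ t ∈ Finset.range T,
      M.γ * ∑ s', (M.P (s, b s) s').toReal * (greedyValue (M.iterate η Q₀ (fun i => ξ i ω) t) s'
        - M.iterate η Q₀ (fun i => ξ i ω) t (s', b s')) := by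
    intro s
    refine (hsq.const_mul L).mono (fun T => ?_) fun T ω => ?_
    · refine Measurable.aestronglyMeasurable ?_
      refine (Finset.measurable_fun_sum _ fun t _ => ?_).const_mul _
      refine (Finset.measurable_fun_sum _ fun s' _ => ?_).const_mul _
      exact (((measurable_greedyValue s').comp (hmeas t)).sub
        ((measurable_pi_apply _).comp (hmeas t))).const_mul _
    · have hγ := M.γ_pos.le
      rw [abs_of_nonneg (mul_nonneg (by positivity) (Finset.sum_nonneg fun t _ => mul_nonneg hγ
        (Finset.sum_nonneg fun s' _ => mul_nonneg ENNReal.toReal_nonneg (hρ0 _ _)))),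
        mul_left_comm L, Finset.mul_sum _ _ L]
      refine mul_le_mul_of_nonneg_left ?_ (by positivity)
      refine (Finset.sum_le_sum fun t _ => ?_).trans (Finset.sum_le_sum_of_subset_of_nonneg
        (Finset.range_mono (Nat.le_succ T)) fun t _ _ => mul_nonneg hL0 (sq_nonneg _))
      refine (mul_le_of_le_one_left (Finset.sum_nonneg fun s' _ =>
        mul_nonneg ENNReal.toReal_nonneg (hρ0 _ _)) M.γ_lt_one.le).trans ?_
      exact sum_toReal_pmf_mul_le _ fun s' => hL _ s'
  have havg : ∀ s, TendstoL1Zero μ fun T ω => √(T : ℝ) *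
      (greedyValue (M.avgQ η Q₀ (fun i => ξ i ω) T) s
        - M.avgQ η Q₀ (fun i => ξ i ω) T (s, b s)) := by
    intro s
    refine (hsq.const_mul L).mono (fun T => ?_) fun T ω => ?_
    · have hm : Measurable fun ω => M.avgQ η Q₀ (fun i => ξ i ω) T :=
        measurable_pi_iff.2 fun x => (Finset.measurable_fun_sum _ fun t _ =>
          (measurable_pi_apply x).comp (hmeas t)).const_mul _
      exact ((((measurable_greedyValue s).comp hm).sub
        ((measurable_pi_apply _).comp hm)).const_mul _).aestronglyMeasurable
    · rw [abs_of_nonneg (mul_nonneg (Real.sqrt_nonneg _) (hρ0 _ _))]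
      calc _ ≤ √(T : ℝ) * (L * ‖M.avgQ η Q₀ (fun i => ξ i ω) T - M.Qstar‖ ^ 2) :=
            mul_le_mul_of_nonneg_left (hL _ s) (Real.sqrt_nonneg _)
        _ = L * (√(T : ℝ) * ‖M.avgQ η Q₀ (fun i => ξ i ω) T - M.Qstar‖ ^ 2) := by ring
        _ ≤ _ := mul_le_mul_of_nonneg_left (sqrt_mul_norm_avgQ_sub_sq_le _ T) hL0
  have hnoise := fun s => hξ.tendstoL1Zero_sum_sampleNoise (Q₀ := Q₀) hR hη hC0 hC (s, b s)
  have htel := fun s => hξ.tendstoL1Zero_telescope (Q₀ := Q₀) hR hη hC (s, b s)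
  have hsub := fun s => hξ.tendstoL1Zero_sub (Q₀ := Q₀) hR hη hC0 hC (s, b s)
  refine ⟨_, fun s => ((havg s).add (hsub s)).add (.sum Finset.univ fun s' =>
    (((hnoise s').add (hlin s')).add (htel s')).const_mul (H s s')), fun T s ω => ?_⟩
  have h1 := sqrt_mul_avgQ_sub (M := M) (η := η) (Q₀ := Q₀) (fun i => ξ i ω) T (s, b s)
  have h2 := congrFun (sum_error_eq (Q₀ := Q₀) hη hQ hb (fun i => ξ i ω) T) s
  have h3 : ∀ t, (H *ᵥ (projMat (fun s => PMF.pure (b s)) *ᵥ M.bellmanNoise (ξ (t + 1) ω))) s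
      = ∑ s', H s s' * M.bellmanNoise (ξ (t + 1) ω) (s', b s') := fun t => by
    rw [projMat_mulVec]
    simp only [mulVec, dotProduct, policyValue_pure]
  rw [← hH] at h2
  simp only [mulVec, dotProduct, mul_add, Finset.sum_add_distrib] at h2
  simp_rw [h3]
  rw [avgV, hV, ← sub_add_sub_cancel _ (M.avgQ η Q₀ (fun i => ξ i ω) T (s, b s)), mul_add, h1, h2,
    Finset.sum_comm, ← one_div]
  simp only [mul_add, Finset.sum_add_distrib, Finset.mul_sum]
  simp only [mul_left_comm (H s _)]
  ring

/-! ### The limit covariance -/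

lemma memLp_bellmanNoise (hR : M.FourthMoment) (x : S × A) :
    MemLp (fun z => M.bellmanNoise z x) 2 M.sampleLaw := by
  simp_rw [bellmanNoise_eq]
  exact M.memLp_sampleNoise hR 1 _ x

lemma covMatrix_resolvent (hR : M.FourthMoment) (π : Policy S A) :
    covMatrix (fun z => (1 - M.γ • M.PdownMat π)⁻¹ *ᵥ (projMat π *ᵥ M.bellmanNoise z)) M.sampleLaw
      = M.varV π := by
  rw [covMatrix_mulVec (X := fun z => projMat π *ᵥ M.bellmanNoise z), varV]
  intro s
  exact memLp_finsetSum _ fun x _ => (memLp_bellmanNoise hR x).const_mul _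

lemma posSemidef_varV (hR : M.FourthMoment) (π : Policy S A) : (M.varV π).PosSemidef := by
  rw [← covMatrix_resolvent hR]
  refine posSemidef_covMatrix fun s => ?_
  simp_rw [mulVec_mulVec]
  exact memLp_finsetSum _ fun x _ => (memLp_bellmanNoise hR x).const_mul _

lemma varV_eq (hR : M.FourthMoment) (π : Policy S A) :
    M.varV π = projMat π * M.varQ π * (projMat π)ᵀ := by
  rw [varV, varQ, covMatrix_mulVec (memLp_bellmanNoise hR)]
  have h := M.inv_PdownMat_mul_projMat π
  calc _ = (1 - M.γ • M.PdownMat π)⁻¹ * projMat π * covMatrix M.bellmanNoise M.sampleLaw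
        * ((1 - M.γ • M.PdownMat π)⁻¹ * projMat π)ᵀ := by
        rw [transpose_mul]; simp only [Matrix.mul_assoc]
    _ = _ := by rw [h, transpose_mul]; simp only [Matrix.mul_assoc]

/-- The central limit theorem for the resolvent applied to the Bellman noises. -/
lemma IsGenerative.tendstoInDistribution_noise (hξ : M.IsGenerative μ ξ) (hR : M.FourthMoment)
    (π : Policy S A) :
    TendstoInDistribution (fun (T : ℕ) ω => (√(T : ℝ))⁻¹ • ∑ t ∈ Finset.range T,
      (WithLp.toLp 2 ((1 - M.γ • M.PdownMat π)⁻¹ *ᵥ (projMat π *ᵥ M.bellmanNoise (ξ (t + 1) ω))) :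
        EuclideanSpace ℝ S))
      atTop id (fun _ => μ) (multivariateGaussian 0 (M.varV π)) := by
  set B := (1 - M.γ • M.PdownMat π)⁻¹ * projMat π with hB
  set f : Sample S A → EuclideanSpace ℝ S := fun z => WithLp.toLp 2 (B *ᵥ M.bellmanNoise z)
    with hf
  have hfm : Measurable f := by
    refine (WithLp.measurable_toLp 2 _).comp (measurable_pi_iff.2 fun s => ?_)
    simp only [mulVec, dotProduct]
    refine Finset.measurable_fun_sum _ fun x _ => Measurable.const_mul ?_ _
    simp_rw [bellmanNoise_eq]
    exact (M.measurable_sampleNoise 1 x).comp (measurable_id.prodMk measurable_const)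
  have hf2 : MemLp f 2 M.sampleLaw := MemLp.of_eval_piLp fun s =>
    memLp_finsetSum _ fun x _ => (memLp_bellmanNoise hR x).const_mul _
  have hf0 : ∀ s, ∫ z, f z s ∂M.sampleLaw = 0 := by
    intro s
    simp only [hf, mulVec, dotProduct]
    rw [integral_finsetSum _ fun x _ =>
      ((memLp_bellmanNoise hR x).integrable one_le_two).const_mul _]
    refine Finset.sum_eq_zero fun x _ => ?_
    simp_rw [integral_const_mul, bellmanNoise_eq, M.integral_sampleNoise hR, mul_zero]
  have hlaw : ∀ t, μ.map (fun ω => f (ξ (t + 1) ω)) = M.sampleLaw.map f := fun t => by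
    rw [← (hξ.measurePreserving t).map_eq, Measure.map_map hfm (hξ.measurable_succ t)]
    rfl
  have hfs : ∀ t, Measurable fun ω => f (ξ (t + 1) ω) := fun t => hfm.comp (hξ.measurable_succ t)
  have h := tendstoInDistribution_inv_sqrt_smul_sum (P := μ) (X := fun t ω => f (ξ (t + 1) ω))
    (hf2.comp_measurePreserving (hξ.measurePreserving 0))
    (fun s => by
      rw [hξ.integral_comp 0 (g := fun z => f z s) (by fun_prop), hf0])
    (hξ.indep.comp (fun _ => f) fun _ => hfm)
    (fun t => ⟨(hfs t).aemeasurable, (hfs 0).aemeasurable, (hlaw t).trans (hlaw 0).symm⟩)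
  have hcov : covMatrix (fun ω => (f (ξ (0 + 1) ω)).ofLp) μ = M.varV π := by
    rw [← covMatrix_resolvent hR]
    ext i j
    simp only [covMatrix, of_apply, mulVec_mulVec, ← hB]
    have hi : ∀ i, Measurable fun z => f z i := fun i => by fun_prop
    rw [← (hξ.measurePreserving 0).map_eq, covariance_map (hi i).aestronglyMeasurable
      (hi j).aestronglyMeasurable (hξ.measurable_succ 0).aemeasurable]
    rfl
  rw [hcov] at h
  simpa only [mulVec_mulVec, ← hB] using h

end Average
end MDP
end QLearning

/-! ### Asymptotic normality of the value estimate -/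

theorem mainTheorem10 {S A : Type*} [Fintype S] [Fintype A] [DecidableEq S] [DecidableEq A]
    [MeasurableSpace S] [MeasurableSingletonClass S]
    [MeasurableSpace A] [MeasurableSingletonClass A]
    (M : QLearning.MDP S A) (hR : M.FourthMoment)
    (πstar : QLearning.Policy S A)
    (hopt : ∀ π : QLearning.Policy S A, M.IsOptimal π ↔ π = πstar)
    (η : ℕ → ℝ) (hη : QLearning.StepSize η) (Q₀ : S × A → ℝ)
    {Ω : Type*} [MeasurableSpace Ω] (μ : Measure Ω) [IsProbabilityMeasure μ]
    (ξ : ℕ → Ω → QLearning.MDP.Sample S A) (hξ : M.IsGenerative μ ξ) :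
    IsUnit (1 - M.γ • M.PdownMat πstar) ∧
    IsUnit (1 - M.γ • M.PupMat πstar) ∧
    M.varV πstar
      = QLearning.projMat πstar * M.varQ πstar * (QLearning.projMat πstar)ᵀ ∧
    (M.varV πstar).PosSemidef ∧
    TendstoInDistribution
      (fun (T : ℕ) (ω : Ω) =>
        (WithLp.toLp 2 fun s => √(T : ℝ) * (M.avgV η Q₀ (fun t => ξ t ω) T s - M.Vstar s) :
          EuclideanSpace ℝ S))
      atTop id (fun _ => μ) (multivariateGaussian (0 : EuclideanSpace ℝ S) (M.varV πstar)) := by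
  refine ⟨M.isUnit_one_sub_PdownMat πstar, M.isUnit_one_sub_PupMat πstar,
    QLearning.MDP.varV_eq hR πstar,
    QLearning.MDP.posSemidef_varV hR πstar, ?_⟩
  have hπ : M.IsOptimal πstar := (hopt _).2 rfl
  obtain ⟨b, hb, hgap⟩ := QLearning.MDP.exists_unique_greedy hopt
  have hV : ∀ s, M.Vstar s = M.Qstar (s, b s) := fun s => by
    rw [← hπ s, QLearning.MDP.Vπ_eq, hπ.Qπ_eq_Qstar, hb, QLearning.MDP.policyValue_pure]
  have hg : ∀ s, QLearning.greedyValue M.Qstar s = M.Qstar (s, b s) := fun s => by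
    rw [← hV, hπ.Vstar_eq_greedyValue]
  obtain ⟨R, hR0, hRe⟩ := hξ.exists_remainder (Q₀ := Q₀) hR hη hπ.bellman_Qstar hgap hg hV
  have hclt := hξ.tendstoInDistribution_noise hR πstar
  rw [← hb] at hRe
  have hsum : ∀ (T : ℕ) (ω : Ω),
      (WithLp.toLp 2 fun s => √(T : ℝ) * (M.avgV η Q₀ (fun t => ξ t ω) T s - M.Vstar s) :
        EuclideanSpace ℝ S)
      = (√(T : ℝ))⁻¹ • ∑ t ∈ Finset.range T, (WithLp.toLp 2 ((1 - M.γ • M.PdownMat πstar)⁻¹ *ᵥ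
          (QLearning.projMat πstar *ᵥ M.bellmanNoise (ξ (t + 1) ω))) : EuclideanSpace ℝ S)
        + WithLp.toLp 2 fun s => R T s ω := by
    intro T ω
    ext s
    rw [PiLp.toLp_apply, hRe]
    simp
  refine tendstoInDistribution_of_tendstoInMeasure_sub _ _ hclt ?_ fun T => ?_
  · convert! QLearning.TendstoL1Zero.tendstoInMeasure hR0 using 1
    ext T ω : 2
    rw [Pi.sub_apply, Pi.sub_apply, hsum, add_sub_cancel_left]
  · simp_rw [hsum]
    exact (hclt.forall_aemeasurable T).add
      (Integrable.of_eval_piLp fun s => (hR0 s).integrable T).aemeasurable
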